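/- Let $X_a, X_v, X_l$ be random variables on a common probability space with values in complete separable metric spaces $\mathcal X_a,\mathcal X_v,\mathcal X_l$ (for instance $\mathcal X_j=\mathbb R^{d_j}$), each with its Borel $\sigma$-algebra, and put $\mathcal X=\mathcal X_a\times\mathcal X_v\times\mathcal X_l$. Let $p$ be the law of $(X_a,X_v,X_l)$ on $\mathcal X$ and let $q=p_{X_a}\otimes p_{X_v}\otimes p_{X_l}$ be the product of the marginal laws. All identities below hold in $[-\infty,\infty]$; neither finiteness nor $p\ll q$ is assumed. 1. **Multivariate mutual information (total correlation).** For $\mathbf I_{kl}=\mathrm{KL}(p\,\|\,q)$, $$\mathbf I_{kl}=\sup_T\; \mathbb E_p[T]-\log \mathbb E_q[e^T],$$ where $T$ runs over all measurable functions $\mathcal X\to\mathbb R$ such that $T$ is $p$-integrable and $e^T$ is $q$-integrable. 2. **Multivariate $f$-mutual information.** Let $f:(0,\infty)\to\mathbb R$ be convex with $f(1)=0$. Put $f(0)=\lim_{u\to0+}f(u)$, $f'(\infty)=\lim_{u\to\infty}f(u)/u$ and $f^*(t)=\sup_{u>0}(ut-f(u))$. Let $p=p_{ac}+p_s$ be the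 Lebesgue decomposition of $p$ with respect to $q$, and let $$\mathbf I_f=D_f(p;q)=\int f\Big(\frac{dp_{ac}}{dq}\Big)\,dq+f'(\infty)\,p_s(\mathcal X),$$ with the convention $\infty\cdot 0=0$. Then $$\mathbf I_f=\sup_T\; \mathbb E_p[T]-\mathbb E_q[f^*(T)],$$ where $T$ runs over all measurable functions $\mathcal X\to\mathbb R$ such that $f^*(T(x))<\infty$ for every $x$, $T$ is $p$-integrable and $f^*(T)$ is $q$-integrable. In particular, for $f(u)=u\log u$, $$\mathbf I_f=\sup_T\; \mathbb E_p[T]-\mathbb E_q[e^{T-1}],$$ where $T$ runs over all measurable functions $\mathcal X\to\mathbb R$ such that $T$ is $p$-integrable and $e^{T-1}$ is $q$-integrable. 3. **Multivariate Wasserstein dependency measure.** Equip $\mathcal X$ with the metric $d(x,x')=\big(d(x_a,x_a')^2+d(x_v,x_v')^2+d(x_l,x_l')^2\big)^{1/2}$ (the Euclidean metric of $\mathbb R^{d_a+d_v+d_l}$ if $\mathcal X_j=\mathbb R^{d_j}$). Let $$\mathbf I_{\mathcal W}=\mathcal W(p,q)=\inf_\pi\int d(x,y)\,d\pi(x,y),$$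 where $\pi$ runs over all couplings of $p$ and $q$. Then $$\mathbf I_{\mathcal W}=\sup_T\; \mathbb E_p[T]-\mathbb E_q[T],$$ where $T$ runs over all $1$-Lipschitz functions $(\mathcal X,d)\to\mathbb R$ that are integrable with respect to both $p$ and $q$. -/

import Mathlib

open MeasureTheory Set Filter Topology
open scoped ENNReal

noncomputable section

/-- The joint law of three random variables. -/
def jointLaw {Ω A V L : Type*} [MeasurableSpace Ω] [MeasurableSpace A] [MeasurableSpace V]
    [MeasurableSpace L] (P : Measure Ω) (Xa : Ω → A) (Xv : Ω → V) (Xl : Ω → L) :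
    Measure (A × V × L) :=
  P.map (fun ω => (Xa ω, Xv ω, Xl ω))

/-- The product of the three marginal laws. -/
def prodLaw {Ω A V L : Type*} [MeasurableSpace Ω] [MeasurableSpace A] [MeasurableSpace V]
    [MeasurableSpace L] (P : Measure Ω) (Xa : Ω → A) (Xv : Ω → V) (Xl : Ω → L) :
    Measure (A × V × L) :=
  (P.map Xa).prod ((P.map Xv).prod (P.map Xl))

/-- Multivariate mutual information (total correlation). -/
def totalCorrelation {Ω A V L : Type*} [MeasurableSpace Ω] [MeasurableSpace A] [MeasurableSpace V]
    [MeasurableSpace L] (P : Measure Ω) (Xa : Ω → A) (Xv : Ω → V) (Xl : Ω → L) : ℝ≥0∞ :=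
  InformationTheory.klDiv (jointLaw P Xa Xv Xl) (prodLaw P Xa Xv Xl)

/-- A generator `f : (0, ∞) → ℝ` extended to `[0, ∞)` by its limit `f(0+)`, which may be `+∞`.
For convex `f` the upper limit is a limit. -/
def generatorExt (f : ℝ → ℝ) (u : ℝ) : EReal :=
  if 0 < u then (f u : EReal) else limsup (fun v => (f v : EReal)) (𝓝[>] (0 : ℝ))

/-- The slope at infinity `f'(∞) = lim f(u) / u` of a generator; it may be `+∞`.
For convex `f` the upper limit is a limit. -/
def slopeAtTop (f : ℝ → ℝ) : EReal :=
  limsup (fun u : ℝ => ((f u / u : ℝ) : EReal)) atTop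

/-- The `f`-divergence `D_f(μ ; ν) = ∫ f(dμ/dν) dν + f'(∞) μ_s(univ)`, where `μ_s` is the part of
`μ` that is singular to `ν`. The integral is that of the positive part minus that of the negative
part; for convex `f` and finite measures the latter is finite, so that `∞ - ∞` does not occur. -/
def fDiv {E : Type*} [MeasurableSpace E] (f : ℝ → ℝ) (μ ν : Measure E) : EReal :=
  ((∫⁻ x, (generatorExt f (μ.rnDeriv ν x).toReal).toENNReal ∂ν : ℝ≥0∞) : EReal)
    - ((∫⁻ x, (-generatorExt f (μ.rnDeriv ν x).toReal).toENNReal ∂ν : ℝ≥0∞) : EReal)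
    + slopeAtTop f * ((μ.singularPart ν univ : ℝ≥0∞) : EReal)

/-- Multivariate `f`-mutual information. -/
def fMutualInfo {Ω A V L : Type*} [MeasurableSpace Ω] [MeasurableSpace A] [MeasurableSpace V]
    [MeasurableSpace L] (f : ℝ → ℝ) (P : Measure Ω) (Xa : Ω → A) (Xv : Ω → V) (Xl : Ω → L) :
    EReal :=
  fDiv f (jointLaw P Xa Xv Xl) (prodLaw P Xa Xv Xl)

/-- The convex conjugate `f*(t) = sup_{u > 0} (u t - f(u))`, with values in `(-∞, ∞]`. -/
def fConj (f : ℝ → ℝ) (t : ℝ) : EReal :=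
  ⨆ (u : ℝ) (_ : 0 < u), ((u * t - f u : ℝ) : EReal)

/-- The couplings of two measures. -/
def couplings {E : Type*} [MeasurableSpace E] (μ ν : Measure E) : Set (Measure (E × E)) :=
  {π | π.map Prod.fst = μ ∧ π.map Prod.snd = ν}

/-- The Wasserstein distance (of order one): the infimum of the transport costs. -/
def wassersteinDist {E : Type*} [PseudoEMetricSpace E] [MeasurableSpace E] (μ ν : Measure E) :
    ℝ≥0∞ :=
  ⨅ π ∈ couplings μ ν, ∫⁻ z, edist z.1 z.2 ∂π

/-- The product `A × V × L` with the metric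
`d((a, v, l), (a', v', l'))² = d(a, a')² + d(v, v')² + d(l, l')²`. -/
abbrev L2Prod (A V L : Type*) : Type _ := WithLp 2 (A × WithLp 2 (V × L))

/-- The identification of `A × V × L` with `L2Prod A V L`. -/
def toL2Prod {A V L : Type*} (x : A × V × L) : L2Prod A V L :=
  WithLp.toLp 2 (x.1, WithLp.toLp 2 (x.2.1, x.2.2))

/-- Multivariate Wasserstein dependency measure. -/
def wassersteinDependency {Ω A V L : Type*} [MeasurableSpace Ω]
    [MetricSpace A] [MeasurableSpace A] [MetricSpace V] [MeasurableSpace V]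
    [MetricSpace L] [MeasurableSpace L]
    (P : Measure Ω) (Xa : Ω → A) (Xv : Ω → V) (Xl : Ω → L) : ℝ≥0∞ :=
  wassersteinDist ((jointLaw P Xa Xv Xl).map toL2Prod) ((prodLaw P Xa Xv Xl).map toL2Prod)

end

/-!
All three formulas hold for arbitrary probability measures `μ`, `ν`; that `ν` is a product of
marginals plays no role.

For the `f`-divergence (`fDiv_eq_iSup`), the Fenchel–Young inequality `u t - f*(t) ≤ f(u)`,
applied with `u = dμ/dν`, bounds the part of `μ` that is absolutely continuous with respect to `ν`,
and `t ≤ f'(∞)` on the domain of `f*` bounds the singular part. Conversely, `f` on `[0, ∞)` is the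
upper envelope of countably many supporting lines, and their slopes `s k` have supremum `f'(∞)`
(`exists_seq_slopes`). The test function that takes at `x` the slope of the best of the first `n`
lines at `u = dμ/dν(x)`, and the largest of these slopes on the singular set, has finitely many
values, hence is admissible, and its value converges to the divergence by monotone convergence.
The relative entropy is the case `f(u) = u log u + 1 - u`, for which `f*(t) = e^t - 1`; as
`log z ≤ z - 1`, with equality once `T` is shifted so that `z = 1`, this gives the
Donsker–Varadhan formula (`coe_klDiv_eq_iSup`).

Kantorovich–Rubinstein duality (`coe_wassersteinDist_eq_iSup`) is proved by discretisation. On `ℕ`,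
the Riesz extension theorem turns a bound for the dual problem into a finitely additive coupling of
bounded cost (`exists_positive_functional`); its marginals are countably additive, which makes the
coupling itself countably additive (`exists_coupling_of_content`). A separable metric space is cut
into countably many pieces of small diameter. Potentials of the discrete dual problem become
Lipschitz functions by the `c`-transform (`integral_add_integral_le_of_potentials`), and a discrete
coupling becomes a coupling of the original laws when the conditional laws on the pieces are glued
in (`wassersteinDist_bind_le`). Neither a first moment nor compactness is needed.
-/

open scoped BoundedContinuousFunction

/-! ### Convex generators and their conjugates -/

/-- A convex function on `(0, ∞)` has a supporting line at each point. -/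
theorem ConvexOn.exists_subgradient {f : ℝ → ℝ} (hf : ConvexOn ℝ (Ioi 0) f) {r : ℝ} (hr : 0 < r) :
    ∃ s : ℝ, ∀ u : ℝ, 0 < u → f r + s * (u - r) ≤ f u := by
  have hi : r ∈ interior (Ioi (0 : ℝ)) := by simpa using hr
  refine ⟨derivWithin f (Ioi r) r, fun u hu => ?_⟩
  rcases lt_trichotomy r u with h | rfl | h
  · have := hf.rightDeriv_le_slope_of_mem_interior hi hu h
    rw [slope_def_field, le_div_iff₀ (by linarith)] at this
    linarith
  · simp
  · have h1 := hf.slope_le_leftDeriv_of_mem_interior hu hi h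
    have h2 := hf.leftDeriv_le_rightDeriv_of_mem_interior hi
    have := h1.trans h2
    rw [slope_def_field, div_le_iff₀ (by linarith)] at this
    linarith

theorem fConj_ne_bot (f : ℝ → ℝ) (t : ℝ) : fConj f t ≠ ⊥ := by
  intro h
  have h1 : ((1 * t - f 1 : ℝ) : EReal) ≤ fConj f t :=
    le_iSup₂ (f := fun (u : ℝ) (_ : 0 < u) => ((u * t - f u : ℝ) : EReal)) 1 one_pos
  rw [h] at h1
  exact EReal.coe_ne_bot _ (le_bot_iff.1 h1)

theorem coe_toReal_fConj {f : ℝ → ℝ} {t : ℝ} (h : fConj f t ≠ ⊤) :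
    (((fConj f t).toReal : ℝ) : EReal) = fConj f t :=
  EReal.coe_toReal h (fConj_ne_bot f t)

/-- The Fenchel–Young inequality. -/
theorem mul_sub_fConj_le {f : ℝ → ℝ} {t : ℝ} (h : fConj f t ≠ ⊤) {u : ℝ} (hu : 0 < u) :
    u * t - (fConj f t).toReal ≤ f u := by
  have h1 : ((u * t - f u : ℝ) : EReal) ≤ fConj f t :=
    le_iSup₂ (f := fun (u : ℝ) (_ : 0 < u) => ((u * t - f u : ℝ) : EReal)) u hu
  rw [← coe_toReal_fConj h, EReal.coe_le_coe_iff] at h1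
  linarith

/-- A value of the conjugate is determined by an upper bound that is attained. -/
theorem fConj_eq_of_isMax {f : ℝ → ℝ} {t c r : ℝ} (hr : 0 < r) (hrc : r * t - f r = c)
    (hle : ∀ u : ℝ, 0 < u → u * t - f u ≤ c) : fConj f t = c := by
  refine le_antisymm (iSup₂_le fun u hu => EReal.coe_le_coe_iff.2 (hle u hu)) ?_
  rw [← hrc]
  exact le_iSup₂ (f := fun (u : ℝ) (_ : 0 < u) => ((u * t - f u : ℝ) : EReal)) r hr

/-- The Fenchel–Young inequality for the generator extended to `[0, ∞)`. -/
theorem mul_sub_fConj_le_generatorExt {f : ℝ → ℝ} {t : ℝ} (h : fConj f t ≠ ⊤) {u : ℝ}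
    (hu : 0 ≤ u) : ((u * t - (fConj f t).toReal : ℝ) : EReal) ≤ generatorExt f u := by
  rcases hu.eq_or_lt with rfl | hu
  · simp only [generatorExt, lt_irrefl, if_false]
    have hl : Tendsto (fun v : ℝ => ((v * t - (fConj f t).toReal : ℝ) : EReal)) (𝓝[>] (0 : ℝ))
        (𝓝 ((0 * t - (fConj f t).toReal : ℝ) : EReal)) := by
      refine (continuous_coe_real_ereal.tendsto _).comp ?_
      refine Tendsto.mono_left ?_ nhdsWithin_le_nhds
      exact Continuous.tendsto (by fun_prop) 0
    rw [← hl.limsup_eq]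
    refine limsup_le_limsup ?_
    filter_upwards [self_mem_nhdsWithin] with v hv
    exact EReal.coe_le_coe_iff.2 (mul_sub_fConj_le h hv)
  · simp only [generatorExt, hu, if_true]
    exact EReal.coe_le_coe_iff.2 (mul_sub_fConj_le h hu)

/-- The conjugate is infinite above the slope at infinity. -/
theorem le_slopeAtTop {f : ℝ → ℝ} {t : ℝ} (h : fConj f t ≠ ⊤) : (t : EReal) ≤ slopeAtTop f := by
  have hl : Tendsto (fun u : ℝ => ((t - (fConj f t).toReal / u : ℝ) : EReal)) atTop
      (𝓝 ((t : ℝ) : EReal)) := by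
    refine (continuous_coe_real_ereal.tendsto _).comp ?_
    simpa using tendsto_const_nhds.sub
      ((tendsto_const_nhds (x := (fConj f t).toReal)).div_atTop tendsto_id)
  rw [← hl.limsup_eq]
  refine limsup_le_limsup ?_
  filter_upwards [eventually_gt_atTop 0] with u hu
  refine EReal.coe_le_coe_iff.2 ?_
  rw [le_div_iff₀ hu, sub_mul, div_mul_cancel₀ _ hu.ne']
  linarith [mul_sub_fConj_le h hu]

/-- A convex generator on `[0, ∞)` is the upper envelope of countably many of its supporting lines,
and its slope at infinity is the supremum of their slopes. -/
theorem exists_seq_slopes {f : ℝ → ℝ} (hf : ConvexOn ℝ (Ioi 0) f) :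
    ∃ s : ℕ → ℝ, (∀ k, fConj f (s k) ≠ ⊤) ∧
      (∀ u : ℝ, 0 ≤ u →
        generatorExt f u ≤ ⨆ k, ((u * s k - (fConj f (s k)).toReal : ℝ) : EReal)) ∧
      slopeAtTop f ≤ ⨆ k, (s k : EReal) := by
  have hsub : ∀ r : ℝ, ∃ s : ℝ, 0 < r → ∀ u : ℝ, 0 < u → f r + s * (u - r) ≤ f u := fun r => by
    by_cases hr : 0 < r
    · obtain ⟨s, hs⟩ := hf.exists_subgradient hr
      exact ⟨s, fun _ => hs⟩
    · exact ⟨0, fun h => absurd h hr⟩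
  choose σ hσ using hsub
  have hmono : ∀ {r r' : ℝ}, 0 < r → r ≤ r' → σ r ≤ σ r' := by
    intro r r' hr hrr'
    rcases hrr'.eq_or_lt with rfl | hlt
    · exact le_rfl
    · have h1 := hσ r hr r' (hr.trans hlt)
      have h2 := hσ r' (hr.trans hlt) r hr
      by_contra hcon
      nlinarith
  have hconj : ∀ r, 0 < r → fConj f (σ r) = ((r * σ r - f r : ℝ) : EReal) := fun r hr =>
    fConj_eq_of_isMax hr rfl fun u hu => by linarith [hσ r hr u hu]
  have hcont : ContinuousOn f (Ioi 0) := hf.continuousOn isOpen_Ioi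
  let d : ℕ → Ioi (0 : ℝ) := TopologicalSpace.denseSeq (Ioi (0 : ℝ))
  have hd : ∀ U : Set ℝ, IsOpen U → (∃ x ∈ U, 0 < x) → ∃ k, (d k : ℝ) ∈ U := by
    rintro U hU ⟨x, hxU, hx⟩
    obtain ⟨_, hy, ⟨k, rfl⟩⟩ :=
      (TopologicalSpace.denseRange_denseSeq (Ioi (0 : ℝ))).inter_open_nonempty (Subtype.val ⁻¹' U) (hU.preimage continuous_subtype_val) ⟨⟨x, hx⟩, hxU⟩
    exact ⟨k, hy⟩
  have hval : ∀ u k, u * σ (d k) - (fConj f (σ (d k))).toReal =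
      f (d k) + σ (d k) * (u - d k) := fun u k => by
    rw [hconj _ (d k).2, EReal.toReal_coe]; ring
  refine ⟨fun k => σ (d k), fun k => ?_, fun u hu => ?_, ?_⟩
  · rw [hconj _ (d k).2]; exact EReal.coe_ne_top _
  · simp only [hval]
    rcases hu.eq_or_lt with rfl | hu
    · simp only [generatorExt, lt_irrefl, if_false]
      refine le_of_forall_lt fun y hy => ?_
      obtain ⟨y₁, hyy₁, hy₁⟩ := EReal.lt_iff_exists_real_btwn.1 hy
      obtain ⟨y₂, hy₁₂, hy₂⟩ := EReal.lt_iff_exists_real_btwn.1 hy₁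
      rw [EReal.coe_lt_coe_iff] at hy₁₂
      have hfr : ∃ᶠ v in 𝓝[>] (0 : ℝ), (y₂ : EReal) < f v :=
        frequently_lt_of_lt_limsup (by isBoundedDefault) hy₂
      have hsmall : ∀ᶠ v in 𝓝[>] (0 : ℝ), v * σ 1 < y₂ - y₁ := by
        have : Tendsto (fun v : ℝ => v * σ 1) (𝓝[>] 0) (𝓝 (0 * σ 1)) :=
          (Continuous.tendsto (by fun_prop) 0).mono_left nhdsWithin_le_nhds
        exact this.eventually_lt_const (by linarith)
      obtain ⟨v, hv, hvs, hv1⟩ := (hfr.and_eventually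
        (hsmall.and (Ioo_mem_nhdsGT (zero_lt_one' ℝ)))).exists
      rw [EReal.coe_lt_coe_iff] at hv
      obtain ⟨k, ⟨-, hk⟩, hk1⟩ := hd _
        (((hcont.sub (g := fun r => r * σ 1) (by fun_prop)).isOpen_inter_preimage isOpen_Ioi
          (isOpen_Ioi (a := y₁))).inter (isOpen_Iio (a := 1)))
        ⟨v, ⟨⟨hv1.1, by simp only [mem_preimage, mem_Ioi, Pi.sub_apply]; linarith⟩, hv1.2⟩, hv1.1⟩
      simp only [mem_preimage, mem_Ioi, Pi.sub_apply, mem_Iio] at hk hk1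
      refine (hyy₁.trans (EReal.coe_lt_coe_iff.2 ?_)).trans_le
        (le_iSup (fun k => ((f (d k) + σ (d k) * (0 - d k) : ℝ) : EReal)) k)
      -- near `0` the slopes of the supporting lines are bounded above by the slope at `1`
      have h1 := hmono (d k).2 hk1.le
      have h2 : (0 : ℝ) < d k := (d k).2
      nlinarith
    · simp only [generatorExt, hu, if_true]
      refine le_of_forall_lt fun y hy => ?_
      obtain ⟨y₁, hyy₁, hy₁⟩ := EReal.lt_iff_exists_real_btwn.1 hy
      rw [EReal.coe_lt_coe_iff] at hy₁
      have hW : IsOpen (Ioi 0 ∩ (fun r => f r + σ (u / 2) * (u - r)) ⁻¹' Ioi y₁) :=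
        (hcont.add (g := fun r => σ (u / 2) * (u - r))
          (by fun_prop)).isOpen_inter_preimage isOpen_Ioi isOpen_Ioi
      have huW : u ∈ Ioi 0 ∩ (fun r => f r + σ (u / 2) * (u - r)) ⁻¹' Ioi y₁ := by
        refine ⟨hu, ?_⟩
        simpa using hy₁
      obtain ⟨v, hvW, hv⟩ : (Ioi 0 ∩ (fun r => f r + σ (u / 2) * (u - r)) ⁻¹' Ioi y₁ ∩
          Ioo (u / 2) u).Nonempty :=
        nonempty_of_mem (f := 𝓝[<] u) (inter_mem (mem_nhdsWithin_of_mem_nhds (hW.mem_nhds huW))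
          (Ioo_mem_nhdsLT (half_lt_self hu)))
      obtain ⟨k, ⟨-, hk⟩, hk1⟩ := hd _ (hW.inter isOpen_Ioo) ⟨v, ⟨hvW, hv⟩, hvW.1⟩
      simp only [mem_preimage, mem_Ioi] at hk
      refine (hyy₁.trans (EReal.coe_lt_coe_iff.2 ?_)).trans_le
        (le_iSup (fun k => ((f (d k) + σ (d k) * (u - d k) : ℝ) : EReal)) k)
      have h1 := hmono (half_pos hu) hk1.1.le
      nlinarith [hk1.2]
  · by_cases hB : (⨆ k, (σ (d k) : EReal)) = ⊤
    · rw [hB]; exact le_top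
    have hB' : (⨆ k, (σ (d k) : EReal)) ≠ ⊥ := fun h =>
      EReal.coe_ne_bot (σ (d 0)) (le_bot_iff.1 (h ▸ le_iSup (fun k => (σ (d k) : EReal)) 0))
    obtain ⟨b, hb⟩ : ∃ b : ℝ, (b : EReal) = ⨆ k, (σ (d k) : EReal) :=
      ⟨_, EReal.coe_toReal hB hB'⟩
    rw [← hb]
    have hσb : ∀ u, 0 < u → σ u ≤ b := fun u hu => by
      obtain ⟨k, hk⟩ := hd (Ioi u) isOpen_Ioi ⟨u + 1, by simp, by linarith⟩
      refine (hmono hu (le_of_lt hk)).trans ?_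
      rw [← EReal.coe_le_coe_iff, hb]
      exact le_iSup (fun k => (σ (d k) : EReal)) k
    have hl : Tendsto (fun u : ℝ => ((f 1 / u + b * (1 - 1 / u) : ℝ) : EReal)) atTop
        (𝓝 ((b : ℝ) : EReal)) := by
      refine (continuous_coe_real_ereal.tendsto _).comp ?_
      have h1 := (tendsto_const_nhds (x := f 1)).div_atTop (tendsto_id (α := ℝ))
      have h2 := (tendsto_const_nhds (x := (1 : ℝ))).div_atTop (tendsto_id (α := ℝ))
      simpa using h1.add ((tendsto_const_nhds (x := b)).mul
        ((tendsto_const_nhds (x := (1 : ℝ))).sub h2))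
    rw [← hl.limsup_eq]
    refine limsup_le_limsup ?_
    filter_upwards [eventually_gt_atTop 1] with u hu
    refine EReal.coe_le_coe_iff.2 ?_
    have hu0 : 0 < u := by linarith
    have h1 := hσ u hu0 1 one_pos
    have h2 := mul_le_mul_of_nonneg_right (hσb u hu0) (sub_nonneg.2 hu.le)
    have h3 : f 1 / u + b * (1 - 1 / u) = (f 1 + b * (u - 1)) / u := by
      field_simp
    rw [h3]
    exact div_le_div_of_nonneg_right (by linarith) hu0.le

/-! ### The variational formula for `f`-divergences -/

section ExtendedIntegral

variable {E : Type*} [MeasurableSpace E] {ν : Measure E}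

theorem coe_integral_eq_lintegral_sub {h : E → ℝ} (hh : Integrable h ν) :
    ((∫ x, h x ∂ν : ℝ) : EReal) = ((∫⁻ x, (h x : EReal).toENNReal ∂ν : ℝ≥0∞) : EReal)
      - ((∫⁻ x, (-(h x : EReal)).toENNReal ∂ν : ℝ≥0∞) : EReal) := by
  have h1 : ∀ r : ℝ, (r : EReal).toENNReal = ENNReal.ofReal r := fun r => by simp
  have h2 : ∀ r : ℝ, (-(r : EReal)).toENNReal = ENNReal.ofReal (-r) := fun r => by
    rw [← EReal.coe_neg, h1]
  simp only [h1, h2]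
  rw [integral_eq_lintegral_pos_part_sub_lintegral_neg_part hh, EReal.coe_sub,
    EReal.coe_ennreal_toReal, EReal.coe_ennreal_toReal]
  · exact hh.neg.lintegral_lt_top.ne
  · exact hh.lintegral_lt_top.ne

theorem coe_integral_le_lintegral_sub {h : E → ℝ} (hh : Integrable h ν) {G : E → EReal}
    (hG : ∀ x, (h x : EReal) ≤ G x) :
    ((∫ x, h x ∂ν : ℝ) : EReal) ≤ ((∫⁻ x, (G x).toENNReal ∂ν : ℝ≥0∞) : EReal)
      - ((∫⁻ x, (-G x).toENNReal ∂ν : ℝ≥0∞) : EReal) := by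
  rw [coe_integral_eq_lintegral_sub hh]
  refine EReal.sub_le_sub ?_ ?_
  · exact EReal.coe_ennreal_le_coe_ennreal_iff.2
      (lintegral_mono fun x => EReal.toENNReal_le_toENNReal (hG x))
  · exact EReal.coe_ennreal_le_coe_ennreal_iff.2
      (lintegral_mono fun x => EReal.toENNReal_le_toENNReal (EReal.neg_le_neg_iff.2 (hG x)))

/-- Monotone convergence for extended real integrals whose negative part is finite. -/
theorem tendsto_coe_integral_of_monotone {h : ℕ → E → ℝ} (hh : ∀ n, Integrable (h n) ν)
    (hmeas : ∀ n, Measurable (h n)) (hmono : ∀ x, Monotone fun n => h n x) {G : E → EReal}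
    (hG : ∀ x, Tendsto (fun n => (h n x : EReal)) atTop (𝓝 (G x))) :
    Tendsto (fun n => ((∫ x, h n x ∂ν : ℝ) : EReal)) atTop
      (𝓝 (((∫⁻ x, (G x).toENNReal ∂ν : ℝ≥0∞) : EReal)
        - ((∫⁻ x, (-G x).toENNReal ∂ν : ℝ≥0∞) : EReal))) := by
  have hm : ∀ n, Measurable fun x => (h n x : EReal) := fun n => (hmeas n).coe_real_ereal
  have h1 : Tendsto (fun n => ∫⁻ x, (h n x : EReal).toENNReal ∂ν) atTop
      (𝓝 (∫⁻ x, (G x).toENNReal ∂ν)) := by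
    refine lintegral_tendsto_of_tendsto_of_monotone (fun n => (hm n).ereal_toENNReal.aemeasurable)
      (ae_of_all _ fun x m n hmn =>
        EReal.toENNReal_le_toENNReal (EReal.coe_le_coe_iff.2 (hmono x hmn)))
      (ae_of_all _ fun x => (EReal.continuous_toENNReal.tendsto _).comp (hG x))
  have hfin : ∫⁻ x, (-(h 0 x : EReal)).toENNReal ∂ν ≠ ∞ := by
    have : ∀ x, (-(h 0 x : EReal)).toENNReal = ENNReal.ofReal (-h 0 x) := fun x => by
      rw [← EReal.coe_neg]; simp
    simp only [this]
    exact (hh 0).neg.lintegral_lt_top.ne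
  have h2 : Tendsto (fun n => ∫⁻ x, (-(h n x : EReal)).toENNReal ∂ν) atTop
      (𝓝 (∫⁻ x, (-G x).toENNReal ∂ν)) := by
    refine lintegral_tendsto_of_tendsto_of_antitone
      (fun n => (hm n).neg.ereal_toENNReal.aemeasurable)
      (ae_of_all _ fun x m n hmn => EReal.toENNReal_le_toENNReal
        (EReal.neg_le_neg_iff.2 (EReal.coe_le_coe_iff.2 (hmono x hmn)))) hfin
      (ae_of_all _ fun x => (EReal.continuous_toENNReal.tendsto _).comp
        ((continuous_neg.tendsto _).comp (hG x)))
  have hfin' : ∫⁻ x, (-G x).toENNReal ∂ν ≠ ∞ := by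
    refine ne_top_of_le_ne_top hfin (lintegral_mono fun x => EReal.toENNReal_le_toENNReal
      (EReal.neg_le_neg_iff.2 ?_))
    exact ge_of_tendsto' (hG x) fun n => EReal.coe_le_coe_iff.2 (hmono x (Nat.zero_le n))
  simp only [fun n => coe_integral_eq_lintegral_sub (hh n), sub_eq_add_neg]
  refine Tendsto.comp (EReal.continuousAt_add (p := (_, _)) (Or.inr ?_) (Or.inl ?_))
    (((continuous_coe_ennreal_ereal.tendsto _).comp h1).prodMk_nhds
      ((continuous_neg.tendsto _).comp ((continuous_coe_ennreal_ereal.tendsto _).comp h2)))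
  · simpa using hfin'
  · simp

end ExtendedIntegral

/-- The integral with respect to `μ` splits along the Lebesgue decomposition of `μ`. -/
theorem integral_eq_integral_singularPart_add {E : Type*} [MeasurableSpace E] {μ ν : Measure E}
    [IsFiniteMeasure μ] [IsFiniteMeasure ν] {T : E → ℝ} (hT : Integrable T μ) :
    Integrable T (μ.singularPart ν) ∧ Integrable (fun x => (μ.rnDeriv ν x).toReal * T x) ν ∧
      ∫ x, T x ∂μ = ∫ x, T x ∂(μ.singularPart ν) + ∫ x, (μ.rnDeriv ν x).toReal * T x ∂ν := by
  have h := Measure.singularPart_add_rnDeriv μ ν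
  have hs : Integrable T (μ.singularPart ν) := hT.mono_measure (Measure.singularPart_le μ ν)
  have hw : Integrable T (ν.withDensity (μ.rnDeriv ν)) :=
    hT.mono_measure (Measure.withDensity_rnDeriv_le μ ν)
  have hw' := (integrable_withDensity_iff_integrable_smul' (Measure.measurable_rnDeriv μ ν)
    (Measure.rnDeriv_lt_top μ ν)).1 hw
  refine ⟨hs, hw', ?_⟩
  conv_lhs => rw [← h]
  rw [integral_add_measure hs hw, integral_withDensity_eq_integral_toReal_smul
    (Measure.measurable_rnDeriv μ ν) (Measure.rnDeriv_lt_top μ ν)]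
  rfl

/-- No test function exceeds the divergence: Fenchel–Young on the absolutely continuous part, and
`t ≤ f'(∞)` on the domain of the conjugate for the singular part. -/
theorem integral_sub_integral_fConj_le_fDiv {E : Type*} [MeasurableSpace E] {μ ν : Measure E}
    [IsFiniteMeasure μ] [IsFiniteMeasure ν] {f : ℝ → ℝ} {T : E → ℝ} (hT : Integrable T μ)
    (hfin : ∀ x, fConj f (T x) ≠ ⊤) (hconj : Integrable (fun x => (fConj f (T x)).toReal) ν) :
    ((∫ x, T x ∂μ - ∫ x, (fConj f (T x)).toReal ∂ν : ℝ) : EReal) ≤ fDiv f μ ν := by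
  obtain ⟨hs, hw, heq⟩ := integral_eq_integral_singularPart_add (ν := ν) hT
  have hac : ((∫ x, (μ.rnDeriv ν x).toReal * T x - (fConj f (T x)).toReal ∂ν : ℝ) : EReal) ≤
      ((∫⁻ x, (generatorExt f (μ.rnDeriv ν x).toReal).toENNReal ∂ν : ℝ≥0∞) : EReal)
        - ((∫⁻ x, (-generatorExt f (μ.rnDeriv ν x).toReal).toENNReal ∂ν : ℝ≥0∞) : EReal) :=
    coe_integral_le_lintegral_sub (hw.sub hconj) fun x =>
      mul_sub_fConj_le_generatorExt (hfin x) ENNReal.toReal_nonneg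
  have hsing : ((∫ x, T x ∂(μ.singularPart ν) : ℝ) : EReal) ≤
      slopeAtTop f * ((μ.singularPart ν univ : ℝ≥0∞) : EReal) := by
    rcases eq_or_ne (μ.singularPart ν) 0 with h0 | h0
    · simp [h0]
    have : Nonempty E := by
      by_contra hE
      rw [not_nonempty_iff] at hE
      exact h0 (Subsingleton.elim _ _)
    rcases eq_or_ne (slopeAtTop f) ⊤ with htop | htop
    · rw [htop, EReal.top_mul_of_pos]
      · exact le_top
      · simpa [pos_iff_ne_zero] using h0
    · have hbot : slopeAtTop f ≠ ⊥ := fun h =>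
        EReal.coe_ne_bot _ (le_bot_iff.1 (h ▸ le_slopeAtTop (hfin this.some)))
      obtain ⟨b, hb⟩ : ∃ b : ℝ, (b : EReal) = slopeAtTop f := ⟨_, EReal.coe_toReal htop hbot⟩
      have hTb : ∀ x, T x ≤ b := fun x => by
        rw [← EReal.coe_le_coe_iff, hb]; exact le_slopeAtTop (hfin x)
      rw [← hb, ← EReal.coe_ennreal_toReal (measure_ne_top _ _), ← EReal.coe_mul,
        EReal.coe_le_coe_iff]
      refine (integral_mono hs (integrable_const b) hTb).trans_eq ?_
      rw [integral_const, smul_eq_mul, mul_comm, Measure.real]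
  rw [integral_sub hw hconj] at hac
  have := add_le_add hac hsing
  rw [← EReal.coe_add] at this
  refine le_trans (le_of_eq ?_) this
  rw [heq]
  congr 1
  ring

/-- The slope of the largest, at `u`, of the affine functions `u ↦ u * s k - f*(s k)`, `k ≤ n`. -/
noncomputable def bestSlope (f : ℝ → ℝ) (s : ℕ → ℝ) : ℕ → ℝ → ℝ
  | 0, _ => s 0
  | n + 1, u =>
    if u * bestSlope f s n u - (fConj f (bestSlope f s n u)).toReal
        < u * s (n + 1) - (fConj f (s (n + 1))).toReal
    then s (n + 1) else bestSlope f s n u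

section BestSlope

variable (f : ℝ → ℝ) (s : ℕ → ℝ)

theorem bestSlope_mem_range (n : ℕ) (u : ℝ) : bestSlope f s n u ∈ range s := by
  induction n with
  | zero => exact ⟨0, rfl⟩
  | succ n ih =>
    rw [bestSlope]
    split_ifs
    · exact ⟨n + 1, rfl⟩
    · exact ih

theorem measurable_bestSlope (n : ℕ) : Measurable (bestSlope f s n) ∧
    Measurable fun u => (fConj f (bestSlope f s n u)).toReal := by
  induction n with
  | zero => exact ⟨measurable_const, measurable_const (a := (fConj f (s 0)).toReal)⟩
  | succ n ih =>
    have hS : MeasurableSet {u | u * bestSlope f s n u - (fConj f (bestSlope f s n u)).toReal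
        < u * s (n + 1) - (fConj f (s (n + 1))).toReal} :=
      measurableSet_lt ((measurable_id.mul ih.1).sub ih.2) (by fun_prop)
    refine ⟨Measurable.ite hS measurable_const ih.1, ?_⟩
    have : (fun u => (fConj f (bestSlope f s (n + 1) u)).toReal) = fun u =>
        if u * bestSlope f s n u - (fConj f (bestSlope f s n u)).toReal
          < u * s (n + 1) - (fConj f (s (n + 1))).toReal
        then (fConj f (s (n + 1))).toReal else (fConj f (bestSlope f s n u)).toReal := by
      funext u
      rw [bestSlope]
      split_ifs <;> rfl
    rw [this]
    exact Measurable.ite hS measurable_const ih.2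

theorem exists_bound_bestSlope (n : ℕ) : ∃ C, ∀ u, |bestSlope f s n u| ≤ C ∧
    |(fConj f (bestSlope f s n u)).toReal| ≤ C := by
  induction n with
  | zero =>
    exact ⟨max |s 0| |(fConj f (s 0)).toReal|, fun u => ⟨le_max_left _ _, le_max_right _ _⟩⟩
  | succ n ih =>
    obtain ⟨C, hC⟩ := ih
    refine ⟨max C (max |s (n + 1)| |(fConj f (s (n + 1))).toReal|), fun u => ?_⟩
    rw [bestSlope]
    split_ifs
    · exact ⟨le_max_of_le_right (le_max_left _ _), le_max_of_le_right (le_max_right _ _)⟩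
    · exact ⟨le_max_of_le_left (hC u).1, le_max_of_le_left (hC u).2⟩

theorem monotone_bestSlope (u : ℝ) :
    Monotone fun n => u * bestSlope f s n u - (fConj f (bestSlope f s n u)).toReal := by
  refine monotone_nat_of_le_succ fun n => ?_
  conv_rhs => rw [bestSlope]
  split_ifs with h
  · exact h.le
  · exact le_rfl

theorem le_bestSlope (n : ℕ) (u : ℝ) : u * s n - (fConj f (s n)).toReal ≤
    u * bestSlope f s n u - (fConj f (bestSlope f s n u)).toReal := by
  cases n with
  | zero => exact le_rfl
  | succ n =>
    rw [bestSlope]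
    split_ifs with h
    · exact le_rfl
    · exact not_lt.1 h

end BestSlope

/-- The variational formula for `f`-divergences. -/
theorem fDiv_eq_iSup {E : Type*} [MeasurableSpace E] (μ ν : Measure E)
    [IsFiniteMeasure μ] [IsFiniteMeasure ν] {f : ℝ → ℝ} (hf : ConvexOn ℝ (Ioi 0) f) :
    fDiv f μ ν = ⨆ (T : E → ℝ) (_ : Measurable T ∧ Integrable T μ ∧
        (∀ x, fConj f (T x) ≠ ⊤) ∧ Integrable (fun x => (fConj f (T x)).toReal) ν),
      ((∫ x, T x ∂μ - ∫ x, (fConj f (T x)).toReal ∂ν : ℝ) : EReal) := by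
  refine le_antisymm ?_ (iSup₂_le fun T hT =>
    integral_sub_integral_fConj_le_fDiv hT.2.1 hT.2.2.1 hT.2.2.2)
  obtain ⟨s, hs, hsF, hsS⟩ := exists_seq_slopes hf
  obtain ⟨N, hN, hN1, hN2⟩ := Measure.mutuallySingular_singularPart μ ν
  have hNμ : ∀ᵐ x ∂(μ.singularPart ν), x ∉ N := measure_eq_zero_iff_ae_notMem.1 hN1
  have hNν : ∀ᵐ x ∂ν, x ∈ N := by
    filter_upwards [measure_eq_zero_iff_ae_notMem.1 hN2] with x hx
    simpa using hx
  set g : E → ℝ := fun x => (μ.rnDeriv ν x).toReal with hg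
  have hgm : Measurable g := (Measure.measurable_rnDeriv μ ν).ennreal_toReal
  have hg0 : ∀ x, 0 ≤ g x := fun x => ENNReal.toReal_nonneg
  -- On the set `N`, which carries `ν`, the test function picks the best supporting line at the
  -- density; on the complement, where only the singular part lives, it picks the largest slope.
  classical
  let T : ℕ → E → ℝ := fun n => N.piecewise (fun x => bestSlope f s n (g x))
    (fun _ => partialSups s n)
  have hTm : ∀ n, Measurable (T n) := fun n =>
    Measurable.piecewise hN ((measurable_bestSlope f s n).1.comp hgm) measurable_const
  have hTr : ∀ n x, T n x ∈ range s := fun n x => by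
    by_cases hx : x ∈ N
    · simp only [T, hx, piecewise_eq_of_mem]
      exact bestSlope_mem_range f s n _
    · simp only [T, hx, not_false_eq_true, piecewise_eq_of_notMem]
      obtain ⟨k, -, hk⟩ := exists_partialSups_eq s n
      exact ⟨k, hk.symm⟩
  have hTfin : ∀ n x, fConj f (T n x) ≠ ⊤ := fun n x => by
    obtain ⟨k, hk⟩ := hTr n x
    rw [← hk]; exact hs k
  have hTν : ∀ n, T n =ᵐ[ν] fun x => bestSlope f s n (g x) := fun n => by
    filter_upwards [hNν] with x hx
    simp only [T, hx, piecewise_eq_of_mem]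
  have hTμ : ∀ n, T n =ᵐ[μ.singularPart ν] fun _ => partialSups s n := fun n => by
    filter_upwards [hNμ] with x hx
    simp only [T, hx, not_false_eq_true, piecewise_eq_of_notMem]
  have hTint : ∀ n, Integrable (T n) μ := fun n => by
    obtain ⟨C, hC⟩ := exists_bound_bestSlope f s n
    refine Integrable.of_bound (hTm n).aestronglyMeasurable (max C |partialSups s n|)
      (ae_of_all _ fun x => ?_)
    by_cases hx : x ∈ N
    · simp only [T, hx, piecewise_eq_of_mem]
      exact le_max_of_le_left (hC _).1
    · simp only [T, hx, not_false_eq_true, piecewise_eq_of_notMem]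
      exact le_max_right _ _
  have hcint : ∀ n, Integrable (fun x => (fConj f (bestSlope f s n (g x))).toReal) ν := fun n => by
    obtain ⟨C, hC⟩ := exists_bound_bestSlope f s n
    exact Integrable.of_bound ((measurable_bestSlope f s n).2.comp hgm).aestronglyMeasurable C
      (ae_of_all _ fun x => (hC _).2)
  have hcT : ∀ n, (fun x => (fConj f (T n x)).toReal) =ᵐ[ν]
      fun x => (fConj f (bestSlope f s n (g x))).toReal := fun n => by
    filter_upwards [hTν n] with x hx
    rw [hx]
  have hgint : ∀ n, Integrable (fun x => g x * bestSlope f s n (g x)) ν := fun n =>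
    (integral_eq_integral_singularPart_add (ν := ν) (hTint n)).2.1.congr (by
      filter_upwards [hTν n] with x hx
      rw [hx])
  have hval : ∀ n, ∫ x, T n x ∂μ - ∫ x, (fConj f (T n x)).toReal ∂ν =
      (∫ x, g x * bestSlope f s n (g x) - (fConj f (bestSlope f s n (g x))).toReal ∂ν)
        + partialSups s n * (μ.singularPart ν univ).toReal := fun n => by
    rw [(integral_eq_integral_singularPart_add (ν := ν) (hTint n)).2.2, integral_congr_ae (hTμ n),
      integral_const, integral_sub (hgint n) (hcint n), integral_congr_ae (hcT n),
      smul_eq_mul, Measure.real]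
    have : ∫ x, (μ.rnDeriv ν x).toReal * T n x ∂ν = ∫ x, g x * bestSlope f s n (g x) ∂ν :=
      integral_congr_ae (by
        filter_upwards [hTν n] with x hx
        rw [hx])
    rw [this]
    ring
  have hac := tendsto_coe_integral_of_monotone (ν := ν)
    (h := fun n x => g x * bestSlope f s n (g x) - (fConj f (bestSlope f s n (g x))).toReal)
    (fun n => (hgint n).sub (hcint n))
    (fun n => (hgm.mul ((measurable_bestSlope f s n).1.comp hgm)).sub
      ((measurable_bestSlope f s n).2.comp hgm))
    (fun x => monotone_bestSlope f s (g x)) (G := fun x => generatorExt f (g x)) (fun x => by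
      have hle : ∀ n, ((g x * bestSlope f s n (g x)
          - (fConj f (bestSlope f s n (g x))).toReal : ℝ) : EReal) ≤ generatorExt f (g x) :=
        fun n => by
          obtain ⟨k, hk⟩ := bestSlope_mem_range f s n (g x)
          rw [← hk]
          exact mul_sub_fConj_le_generatorExt (hs k) (hg0 x)
      have heq : generatorExt f (g x) = ⨆ n, ((g x * bestSlope f s n (g x)
          - (fConj f (bestSlope f s n (g x))).toReal : ℝ) : EReal) :=
        le_antisymm ((hsF _ (hg0 x)).trans (iSup_mono fun n =>
          EReal.coe_le_coe_iff.2 (le_bestSlope f s n (g x)))) (iSup_le hle)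
      rw [heq]
      exact tendsto_atTop_iSup fun m n hmn =>
        EReal.coe_le_coe_iff.2 (monotone_bestSlope f s (g x) hmn))
  have hslope : Tendsto (fun n => ((partialSups s n : ℝ) : EReal)) atTop (𝓝 (slopeAtTop f)) := by
    have heq : slopeAtTop f = ⨆ n, ((partialSups s n : ℝ) : EReal) :=
      le_antisymm (hsS.trans (iSup_mono fun n => EReal.coe_le_coe_iff.2 (le_partialSups s n)))
        (iSup_le fun n => by
          obtain ⟨k, -, hk⟩ := exists_partialSups_eq s n
          rw [hk]
          exact le_slopeAtTop (hs k))
    rw [heq]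
    exact tendsto_atTop_iSup fun m n hmn =>
      EReal.coe_le_coe_iff.2 ((partialSups s).monotone hmn)
  have hsing : Tendsto (fun n => ((partialSups s n * (μ.singularPart ν univ).toReal : ℝ) : EReal))
      atTop (𝓝 (slopeAtTop f * ((μ.singularPart ν univ : ℝ≥0∞) : EReal))) := by
    rw [← EReal.coe_ennreal_toReal (measure_ne_top _ _)]
    simp only [EReal.coe_mul]
    exact EReal.Tendsto.mul_const hslope (Or.inr (EReal.coe_ne_bot _)) (Or.inr (EReal.coe_ne_top _))
  have hlim : Tendsto (fun n => ((∫ x, T n x ∂μ - ∫ x, (fConj f (T n x)).toReal ∂ν : ℝ) : EReal))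
      atTop (𝓝 (fDiv f μ ν)) := by
    simp only [hval, EReal.coe_add]
    rw [fDiv]
    refine (ContinuousAt.tendsto (EReal.continuousAt_add (p := (_, _))
      (Or.inr ?_) (Or.inl ?_))).comp (hac.prodMk_nhds hsing)
    · refine ne_bot_of_le_ne_bot (EReal.coe_ne_bot (partialSups s 0 * _)) (ge_of_tendsto' hsing
        fun n => EReal.coe_le_coe_iff.2 (mul_le_mul_of_nonneg_right
          ((partialSups s).monotone (Nat.zero_le n)) ENNReal.toReal_nonneg))
    · refine ne_bot_of_le_ne_bot (EReal.coe_ne_bot (∫ x, g x * bestSlope f s 0 (g x)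
        - (fConj f (bestSlope f s 0 (g x))).toReal ∂ν)) (ge_of_tendsto' hac
        fun n => EReal.coe_le_coe_iff.2 (integral_mono ((hgint 0).sub (hcint 0))
          ((hgint n).sub (hcint n)) fun x => monotone_bestSlope f s (g x) (Nat.zero_le n)))
  refine le_of_tendsto' hlim fun n => ?_
  exact le_iSup₂ (f := fun (T : E → ℝ) (_ : Measurable T ∧ Integrable T μ ∧
      (∀ x, fConj f (T x) ≠ ⊤) ∧ Integrable (fun x => (fConj f (T x)).toReal) ν) =>
    ((∫ x, T x ∂μ - ∫ x, (fConj f (T x)).toReal ∂ν : ℝ) : EReal)) (T n)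
    ⟨hTm n, hTint n, hTfin n, (hcint n).congr (hcT n).symm⟩

/-! ### Relative entropy -/

theorem fConj_mul_log (t : ℝ) :
    fConj (fun u => u * Real.log u) t = ((Real.exp (t - 1) : ℝ) : EReal) := by
  refine fConj_eq_of_isMax (Real.exp_pos (t - 1)) ?_ fun u hu => ?_
  · rw [Real.log_exp]; ring
  · have h := Real.add_one_le_exp (t - 1 - Real.log u)
    rw [Real.exp_sub, Real.exp_log hu, le_div_iff₀ hu] at h
    linarith

theorem fConj_klFun (t : ℝ) :
    fConj InformationTheory.klFun t = ((Real.exp t - 1 : ℝ) : EReal) := by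
  refine fConj_eq_of_isMax (Real.exp_pos t) ?_ fun u hu => ?_
  · rw [InformationTheory.klFun_apply, Real.log_exp]; ring
  · have h := Real.add_one_le_exp (t - Real.log u)
    rw [Real.exp_sub, Real.exp_log hu, le_div_iff₀ hu] at h
    rw [InformationTheory.klFun_apply]
    linarith

theorem slopeAtTop_klFun : slopeAtTop InformationTheory.klFun = ⊤ := by
  refine EReal.eq_top_iff_forall_lt _ |>.2 fun t => ?_
  refine lt_of_lt_of_le (EReal.coe_lt_coe_iff.2 (lt_add_one t)) (le_slopeAtTop ?_)
  rw [fConj_klFun]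
  exact EReal.coe_ne_top _

theorem generatorExt_klFun {u : ℝ} (hu : 0 ≤ u) :
    generatorExt InformationTheory.klFun u = (InformationTheory.klFun u : EReal) := by
  rcases hu.eq_or_lt with rfl | hu
  · simp only [generatorExt, lt_irrefl, if_false]
    refine Tendsto.limsup_eq ((continuous_coe_real_ereal.tendsto _).comp ?_)
    exact (InformationTheory.continuous_klFun.tendsto 0).mono_left nhdsWithin_le_nhds
  · simp only [generatorExt, hu, if_true]

/-- The relative entropy is the `f`-divergence of the nonnegative generator
`u ↦ u * log u + 1 - u`. -/
theorem coe_klDiv_eq_fDiv {E : Type*} [MeasurableSpace E] (μ ν : Measure E)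
    [IsFiniteMeasure μ] [IsFiniteMeasure ν] :
    ((InformationTheory.klDiv μ ν : ℝ≥0∞) : EReal) = fDiv InformationTheory.klFun μ ν := by
  have h0 : ∀ x, 0 ≤ (μ.rnDeriv ν x).toReal := fun x => ENNReal.toReal_nonneg
  have hpos : ∀ x, (generatorExt InformationTheory.klFun (μ.rnDeriv ν x).toReal).toENNReal =
      ENNReal.ofReal (InformationTheory.klFun (μ.rnDeriv ν x).toReal) := fun x => by
    rw [generatorExt_klFun (h0 x)]; simp
  have hneg : ∀ x, (-generatorExt InformationTheory.klFun (μ.rnDeriv ν x).toReal).toENNReal = 0 :=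
    fun x => by
      rw [generatorExt_klFun (h0 x), ← EReal.coe_neg]
      simpa using InformationTheory.klFun_nonneg (h0 x)
  simp only [fDiv, hpos, hneg, slopeAtTop_klFun, lintegral_zero, EReal.coe_ennreal_zero, sub_zero]
  rw [InformationTheory.klDiv_eq_lintegral_klFun]
  split_ifs with hac
  · simp [Measure.singularPart_eq_zero_of_ac hac]
  · have hs : μ.singularPart ν univ ≠ 0 := fun h => hac
      ((Measure.singularPart_eq_zero _ _).1 (Measure.measure_univ_eq_zero.1 h))
    rw [EReal.top_mul_of_pos (by simpa [pos_iff_ne_zero] using hs),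
      EReal.add_top_of_ne_bot (by simp)]
    rfl

/-- The Donsker–Varadhan formula. It follows from the variational formula of the `f`-divergence
because the two functionals have the same supremum along each line `T + ℝ`. -/
theorem coe_klDiv_eq_iSup {E : Type*} [MeasurableSpace E] (μ ν : Measure E)
    [IsProbabilityMeasure μ] [IsProbabilityMeasure ν] :
    ((InformationTheory.klDiv μ ν : ℝ≥0∞) : EReal) =
      ⨆ (T : E → ℝ) (_ : Measurable T ∧ Integrable T μ ∧ Integrable (fun x => Real.exp (T x)) ν),
        ((∫ x, T x ∂μ - Real.log (∫ x, Real.exp (T x) ∂ν) : ℝ) : EReal) := by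
  rw [coe_klDiv_eq_fDiv, fDiv_eq_iSup μ ν InformationTheory.convexOn_Ioi_klFun]
  simp only [fConj_klFun, EReal.toReal_coe]
  refine le_antisymm (iSup₂_le fun T hT => ?_) (iSup₂_le fun T hT => ?_)
  · have hexp : Integrable (fun x => Real.exp (T x)) ν :=
      (hT.2.2.2.add (integrable_const (1 : ℝ))).congr (ae_of_all _ fun x => by simp)
    refine le_trans (EReal.coe_le_coe_iff.2 ?_) (le_iSup₂ (f := fun (T : E → ℝ)
      (_ : Measurable T ∧ Integrable T μ ∧ Integrable (fun x => Real.exp (T x)) ν) =>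
        ((∫ x, T x ∂μ - Real.log (∫ x, Real.exp (T x) ∂ν) : ℝ) : EReal)) T ⟨hT.1, hT.2.1, hexp⟩)
    rw [integral_sub hexp (integrable_const _), integral_const]
    have := Real.log_le_sub_one_of_pos (integral_exp_pos hexp)
    simp only [probReal_univ, smul_eq_mul]
    linarith
  · -- the shift by the logarithm of the partition function normalises `exp T` to a density
    set c := Real.log (∫ x, Real.exp (T x) ∂ν) with hc
    have hZ := integral_exp_pos hT.2.2
    have hexp : ∀ x, Real.exp (T x - c) - 1 = Real.exp (T x) / (∫ x, Real.exp (T x) ∂ν) - 1 :=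
      fun x => by rw [Real.exp_sub, hc, Real.exp_log hZ]
    refine le_trans (EReal.coe_le_coe_iff.2 (le_of_eq ?_)) (le_iSup₂ (f := fun (T : E → ℝ)
      (_ : Measurable T ∧ Integrable T μ ∧ (∀ x, ((Real.exp (T x) - 1 : ℝ) : EReal) ≠ ⊤) ∧
        Integrable (fun x => Real.exp (T x) - 1) ν) =>
        ((∫ x, T x ∂μ - ∫ x, (Real.exp (T x) - 1) ∂ν : ℝ) : EReal)) (fun x => T x - c)
        ⟨hT.1.sub_const c, hT.2.1.sub (integrable_const c), fun x => EReal.coe_ne_top _, ?_⟩)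
    · simp only [hexp]
      rw [integral_sub (hT.2.2.div_const _) (integrable_const _), integral_div, div_self hZ.ne',
        integral_sub hT.2.1 (integrable_const _)]
      simp
    · simp only [hexp]
      exact (hT.2.2.div_const _).sub (integrable_const _)

/-- The variational formula for the generator `u ↦ u * log u`. -/
theorem fDiv_mul_log_eq_iSup {E : Type*} [MeasurableSpace E] (μ ν : Measure E)
    [IsFiniteMeasure μ] [IsFiniteMeasure ν] :
    fDiv (fun u => u * Real.log u) μ ν =
      ⨆ (T : E → ℝ) (_ : Measurable T ∧ Integrable T μ ∧
          Integrable (fun x => Real.exp (T x - 1)) ν),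
        ((∫ x, T x ∂μ - ∫ x, Real.exp (T x - 1) ∂ν : ℝ) : EReal) := by
  rw [fDiv_eq_iSup μ ν (Real.convexOn_mul_log.subset Ioi_subset_Ici_self (convex_Ioi 0))]
  simp only [fConj_mul_log, EReal.toReal_coe, ne_eq, EReal.coe_ne_top, not_false_eq_true,
    implies_true, true_and]

/-! ### Kantorovich duality on a countable space -/

/-- The functions on `ℕ × ℕ` that are bounded by a multiple of `1 + c`. -/
def boundedByCost (c : ℕ × ℕ → ℝ) : Submodule ℝ (ℕ × ℕ → ℝ) where
  carrier := {h | ∃ C, ∀ z, |h z| ≤ C * (1 + |c z|)}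
  zero_mem' := ⟨0, by simp⟩
  add_mem' := by
    rintro g h ⟨C, hC⟩ ⟨D, hD⟩
    refine ⟨C + D, fun z => (abs_add_le _ _).trans ?_⟩
    rw [add_mul]
    exact add_le_add (hC z) (hD z)
  smul_mem' := by
    rintro r h ⟨C, hC⟩
    refine ⟨|r| * C, fun z => ?_⟩
    rw [Pi.smul_apply, smul_eq_mul, abs_mul, mul_assoc]
    exact mul_le_mul_of_nonneg_left (hC z) (abs_nonneg r)

/-- The variables of the dual transport problem: two potentials and the multiplier of the cost. -/
abbrev DualVariable : Type := (ℕ →ᵇ ℝ) × (ℕ →ᵇ ℝ) × ℝ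

/-- A positive functional on functions on `ℕ × ℕ` with prescribed marginals and bounded cost. It is
obtained from the Riesz extension theorem on the space of pairs of a dual variable `(φ, ψ, r)` and
a function `h`, with the cone of the pairs that satisfy `φ ⊕ ψ + r c + h ≥ 0` and `r ≥ 0`; there
the dual variables form a direct summand, so that the functional to be extended is well defined. -/
theorem exists_positive_functional (μ ν : Measure ℕ) [IsProbabilityMeasure μ]
    [IsProbabilityMeasure ν] (c : ℕ × ℕ → ℝ) (hc : ∀ z, 0 ≤ c z) (K : ℝ)
    (hK : ∀ (φ ψ : ℕ →ᵇ ℝ) (r : ℝ), 0 ≤ r → (∀ i j, φ i + ψ j ≤ r * c (i, j)) →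
      ∫ i, φ i ∂μ + ∫ j, ψ j ∂ν ≤ r * K) :
    ∃ F : boundedByCost c →ₗ[ℝ] ℝ, (∀ h, (∀ z, 0 ≤ h.1 z) → 0 ≤ F h) ∧
      (∀ (h : boundedByCost c) (φ : ℕ →ᵇ ℝ), (∀ z, h.1 z = φ z.1) → F h = ∫ i, φ i ∂μ) ∧
      (∀ (h : boundedByCost c) (ψ : ℕ →ᵇ ℝ), (∀ z, h.1 z = ψ z.2) → F h = ∫ j, ψ j ∂ν) ∧
      (∀ h : boundedByCost c, (∀ z, h.1 z = c z) → F h ≤ K) := by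
  let S : PointedCone ℝ (DualVariable × boundedByCost c) :=
    { carrier := {x | (∀ z, 0 ≤ x.1.1 z.1 + x.1.2.1 z.2 + x.1.2.2 * c z + x.2.1 z) ∧ 0 ≤ x.1.2.2}
      zero_mem' := by simp
      add_mem' := by
        rintro x y ⟨hx, hx'⟩ ⟨hy, hy'⟩
        refine ⟨fun z => ?_, add_nonneg hx' hy'⟩
        have := add_nonneg (hx z) (hy z)
        simp only [Prod.fst_add, Prod.snd_add, BoundedContinuousFunction.coe_add, Pi.add_apply,
          Submodule.coe_add]
        linarith
      smul_mem' := by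
        rintro ⟨r, hr⟩ x ⟨hx, hx'⟩
        refine ⟨fun z => ?_, mul_nonneg hr hx'⟩
        have := mul_nonneg hr (hx z)
        have h1 : ∀ a b d e k : ℝ, r * (a + b + d * k + e) = r * a + r * b + r * d * k + r * e :=
          fun _ _ _ _ _ => by ring
        rw [h1] at this
        exact this }
  have hint : ∀ (η : Measure ℕ) [IsProbabilityMeasure η] (φ : ℕ →ᵇ ℝ),
      Integrable (fun i => φ i) η := fun η _ φ => φ.integrable η
  let ℓ : DualVariable →ₗ[ℝ] ℝ :=
    { toFun := fun v => ∫ i, v.1 i ∂μ + ∫ j, v.2.1 j ∂ν + v.2.2 * K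
      map_add' := fun v w => by
        simp only [Prod.fst_add, Prod.snd_add, BoundedContinuousFunction.coe_add, Pi.add_apply]
        rw [integral_add (hint μ _) (hint μ _), integral_add (hint ν _) (hint ν _)]
        ring
      map_smul' := fun r v => by
        simp only [Prod.smul_fst, Prod.smul_snd, BoundedContinuousFunction.coe_smul, smul_eq_mul,
          RingHom.id_apply]
        rw [integral_const_mul, integral_const_mul]
        ring }
  let L : (DualVariable × boundedByCost c) →ₗ.[ℝ] ℝ :=
    ⟨Submodule.prod ⊤ ⊥,
      (ℓ.comp (LinearMap.fst ℝ DualVariable (boundedByCost c))).comp (Submodule.subtype _)⟩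
  obtain ⟨g, hgL, hgS⟩ := riesz_extension S L (by
    rintro ⟨⟨v, h⟩, hv⟩ ⟨hx, hx'⟩
    have h0 : h = 0 := hv.2
    subst h0
    have := hK (-v.1) (-v.2.1) v.2.2 hx' fun i j => by
      have := hx (i, j)
      simp only [ZeroMemClass.coe_zero, Pi.zero_apply] at this
      simp only [BoundedContinuousFunction.coe_neg, Pi.neg_apply]
      linarith
    simp only [BoundedContinuousFunction.coe_neg, Pi.neg_apply, integral_neg] at this
    change 0 ≤ ∫ i, v.1 i ∂μ + ∫ j, v.2.1 j ∂ν + v.2.2 * K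
    linarith) (by
    rintro ⟨v, h⟩
    obtain ⟨C, hC⟩ := h.2
    have hC0 : 0 ≤ C := by
      have h1 : 0 ≤ C * (1 + |c (0, 0)|) := (abs_nonneg _).trans (hC (0, 0))
      by_contra hcon
      nlinarith [abs_nonneg (c (0, 0))]
    refine ⟨⟨(-v + (BoundedContinuousFunction.const ℕ C, 0, C), 0), trivial, rfl⟩, fun z => ?_, ?_⟩
    · have h1 := neg_le_of_abs_le (hC z)
      rw [abs_of_nonneg (hc z)] at h1
      simp
      linarith
    · simpa using hC0)
  have hg : ∀ v, g (v, 0) = ℓ v := fun v => hgL ⟨(v, 0), trivial, rfl⟩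
  have hsub : ∀ v h, g (v, h) = ℓ v + g (0, h) := fun v h => by
    rw [← hg, ← map_add]; simp
  -- The cone inequality; applied to `h` and to `-h` it gives the prescribed marginals.
  have hle : ∀ (v : DualVariable) (h : boundedByCost c), 0 ≤ v.2.2 →
      (∀ z, 0 ≤ v.1 z.1 + v.2.1 z.2 + v.2.2 * c z + h.1 z) → 0 ≤ ℓ v + g (0, h) :=
    fun v h h1 h2 => hsub v h ▸ hgS _ ⟨h2, h1⟩
  refine ⟨g.comp (LinearMap.inr ℝ DualVariable (boundedByCost c)), fun h hh => ?_, fun h φ hφ => ?_,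
    fun h ψ hψ => ?_, fun h hh => ?_⟩
  · exact hgS _ ⟨fun z => by simpa using hh z, le_rfl⟩
  · have h1 := hle (-φ, 0, 0) h le_rfl fun z => by simp [hφ]
    have h2 := hle (φ, 0, 0) (-h) le_rfl fun z => by simp [hφ]
    have h3 : g (0, -h) = - g (0, h) := by rw [← map_neg]; simp
    rw [h3] at h2
    simp [ℓ, integral_neg] at h1 h2 ⊢
    linarith
  · have h1 := hle (0, -ψ, 0) h le_rfl fun z => by simp [hψ]
    have h2 := hle (0, ψ, 0) (-h) le_rfl fun z => by simp [hψ]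
    have h3 : g (0, -h) = - g (0, h) := by rw [← map_neg]; simp
    rw [h3] at h2
    simp [ℓ, integral_neg] at h1 h2 ⊢
    linarith
  · have h2 := hle (0, 0, 1) (-h) zero_le_one fun z => by simp [hh]
    have h3 : g (0, -h) = - g (0, h) := by rw [← map_neg]; simp
    rw [h3] at h2
    simp [ℓ] at h2 ⊢
    linarith

theorem tendsto_measureReal_Ici (η : Measure ℕ) [IsProbabilityMeasure η] :
    Tendsto (fun n => η.real (Ici n)) atTop (𝓝 0) := by
  have h := tendsto_measure_iInter_atTop (μ := η) (s := fun n : ℕ => Ici n)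
    (fun n => MeasurableSet.of_discrete.nullMeasurableSet)
    (fun m n hmn => Ici_subset_Ici.2 hmn) ⟨0, measure_ne_top _ _⟩
  have h0 : ⋂ n : ℕ, Ici n = (∅ : Set ℕ) :=
    eq_empty_of_forall_notMem fun k hk => by simpa using mem_iInter.1 hk (k + 1)
  rw [h0, measure_empty] at h
  exact (ENNReal.tendsto_toReal ENNReal.zero_ne_top).comp h

/-- A finitely additive set function on a countable set that exhausts the mass of `A` along a
sequence of distinct points is the sum of its point masses on `A`. -/
theorem hasSum_of_content {ι : Type*} {m : Set ι → ℝ} (h0 : ∀ S, 0 ≤ m S)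
    (hadd : ∀ S T, Disjoint S T → m (S ∪ T) = m S + m T) {ρ : ℕ → ι} (hρ : Function.Injective ρ)
    (ht : Tendsto (fun n => m (ρ '' Ici n)) atTop (𝓝 0)) :
    HasSum (fun k => m {ρ k}) (m (range ρ)) := by
  have hempty : m ∅ = 0 := by simpa using hadd ∅ ∅ (disjoint_empty _)
  have hfin : ∀ n, m (ρ '' Iio n) = ∑ k ∈ Finset.range n, m {ρ k} := fun n => by
    induction n with
    | zero => simp [hempty]
    | succ n ih =>
      rw [Finset.sum_range_succ, ← ih, ← hadd]
      · congr 1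
        ext z
        simp only [mem_image, mem_Iio, Order.lt_add_one_iff, union_singleton, mem_insert_iff]
        constructor
        · rintro ⟨k, hk, rfl⟩
          rcases hk.eq_or_lt with rfl | hk
          · exact Or.inl rfl
          · exact Or.inr ⟨k, hk, rfl⟩
        · rintro (rfl | ⟨k, hk, rfl⟩)
          · exact ⟨n, le_rfl, rfl⟩
          · exact ⟨k, hk.le, rfl⟩
      · rw [disjoint_singleton_right]
        rintro ⟨k, hk, hkn⟩
        exact (ne_of_lt hk) (hρ hkn)
  have hsplit : ∀ n, m (range ρ) = ∑ k ∈ Finset.range n, m {ρ k} + m (ρ '' Ici n) := fun n => by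
    rw [← hfin, ← hadd, ← image_union, Iio_union_Ici, image_univ]
    exact (disjoint_image_iff hρ).2 (Iio_disjoint_Ici le_rfl)
  rw [hasSum_iff_tendsto_nat_of_nonneg fun k => h0 _]
  have : (fun n => ∑ k ∈ Finset.range n, m {ρ k}) = fun n => m (range ρ) - m (ρ '' Ici n) :=
    funext fun n => by rw [hsplit n]; ring
  rw [this]
  simpa using (tendsto_const_nhds (x := m (range ρ))).sub ht

/-- A finitely additive coupling of two probability measures on `ℕ` is countably additive, because
its marginals prevent mass from escaping to infinity. -/
theorem exists_coupling_of_content (μ ν : Measure ℕ) [IsProbabilityMeasure μ]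
    [IsProbabilityMeasure ν] {m : Set (ℕ × ℕ) → ℝ} (h0 : ∀ S, 0 ≤ m S)
    (hadd : ∀ S T, Disjoint S T → m (S ∪ T) = m S + m T)
    (hμ : ∀ S, m (Prod.fst ⁻¹' S) = μ.real S) (hν : ∀ S, m (Prod.snd ⁻¹' S) = ν.real S) :
    ∃ π ∈ couplings μ ν, ∀ z, π {z} = ENNReal.ofReal (m {z}) := by
  have hmono : ∀ {S T}, S ⊆ T → m S ≤ m T := fun {S T} hST => by
    rw [← union_sdiff_cancel hST, hadd _ _ disjoint_sdiff_right]
    linarith [h0 (T \ S)]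
  have hrows : ∀ i, HasSum (fun j => m {(i, j)}) (μ.real {i}) := fun i => by
    have hr : range (Prod.mk i : ℕ → ℕ × ℕ) = Prod.fst ⁻¹' {i} := by
      ext ⟨a, b⟩; simp [eq_comm]
    rw [← hμ, ← hr]
    refine hasSum_of_content h0 hadd (Prod.mk_right_injective i)
      (squeeze_zero (fun n => h0 _) (fun n => ?_) (tendsto_measureReal_Ici ν))
    rw [← hν]
    exact hmono (by rintro _ ⟨j, hj, rfl⟩; exact hj)
  have hcols : ∀ j, HasSum (fun i => m {(i, j)}) (ν.real {j}) := fun j => by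
    have hr : range (fun i : ℕ => (i, j)) = Prod.snd ⁻¹' {j} := by
      ext ⟨a, b⟩; simp [eq_comm]
    rw [← hν, ← hr]
    refine hasSum_of_content h0 hadd (Prod.mk_left_injective j)
      (squeeze_zero (fun n => h0 _) (fun n => ?_) (tendsto_measureReal_Ici μ))
    rw [← hμ]
    exact hmono (by rintro _ ⟨i, hi, rfl⟩; exact hi)
  have hπ : ∀ S, Measure.sum (fun z => ENNReal.ofReal (m {z}) • Measure.dirac z) S =
      ∑' i, ∑' j, ENNReal.ofReal (m {(i, j)}) * S.indicator 1 (i, j) := fun S => by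
    rw [Measure.sum_apply _ MeasurableSet.of_discrete,
      ← ENNReal.tsum_prod (f := fun i j => ENNReal.ofReal (m {(i, j)}) * S.indicator 1 (i, j))]
    simp only [Measure.smul_apply, Measure.dirac_apply, smul_eq_mul]
  refine ⟨Measure.sum fun z => ENNReal.ofReal (m {z}) • Measure.dirac z, ⟨?_, ?_⟩, fun z => ?_⟩
  · refine Measure.ext_of_singleton fun i => ?_
    rw [Measure.map_apply measurable_fst MeasurableSet.of_discrete, hπ, tsum_eq_single i]
    · have h1 : ∀ j, (Prod.fst ⁻¹' {i}).indicator (1 : ℕ × ℕ → ℝ≥0∞) (i, j) = 1 := fun j =>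
        indicator_of_mem rfl 1
      simp only [h1, mul_one]
      rw [← ENNReal.ofReal_tsum_of_nonneg (fun _ => h0 _) (hrows i).summable, (hrows i).tsum_eq,
        ofReal_measureReal]
    · intro i' hi'
      simp [hi']
  · refine Measure.ext_of_singleton fun j => ?_
    rw [Measure.map_apply measurable_snd MeasurableSet.of_discrete, hπ, ENNReal.tsum_comm,
      tsum_eq_single j]
    · have h1 : ∀ i, (Prod.snd ⁻¹' {j}).indicator (1 : ℕ × ℕ → ℝ≥0∞) (i, j) = 1 := fun i =>
        indicator_of_mem rfl 1
      simp only [h1, mul_one]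
      rw [← ENNReal.ofReal_tsum_of_nonneg (fun _ => h0 _) (hcols j).summable, (hcols j).tsum_eq,
        ofReal_measureReal]
    · intro j' hj'
      simp [hj']
  · rw [hπ, tsum_eq_single z.1, tsum_eq_single z.2]
    · simp
    · intro j hj
      simp [Prod.ext_iff, hj]
    · intro i hi
      simp [Prod.ext_iff, hi]

/-- Kantorovich duality on `ℕ`: a bound for the dual problem is a bound for the cost of some
coupling. -/
theorem exists_coupling_nat (μ ν : Measure ℕ) [IsProbabilityMeasure μ]
    [IsProbabilityMeasure ν] (c : ℕ × ℕ → ℝ) (hc : ∀ z, 0 ≤ c z) (K : ℝ)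
    (hK : ∀ (φ ψ : ℕ →ᵇ ℝ) (r : ℝ), 0 ≤ r → (∀ i j, φ i + ψ j ≤ r * c (i, j)) →
      ∫ i, φ i ∂μ + ∫ j, ψ j ∂ν ≤ r * K) :
    ∃ π ∈ couplings μ ν, ∫⁻ z, ENNReal.ofReal (c z) ∂π ≤ ENNReal.ofReal K := by
  obtain ⟨F, hF0, hFμ, hFν, hFc⟩ := exists_positive_functional μ ν c hc K hK
  have hbdd : ∀ S : Set (ℕ × ℕ), S.indicator (fun _ => (1 : ℝ)) ∈ boundedByCost c := fun S =>
    ⟨1, fun z => by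
      have := abs_nonneg (c z)
      by_cases hz : z ∈ S <;> simp [hz]; linarith⟩
  let e : Set (ℕ × ℕ) → boundedByCost c := fun S => ⟨_, hbdd S⟩
  have he : ∀ S z, (e S).1 z = S.indicator (fun _ => (1 : ℝ)) z := fun S z => rfl
  let χ : Set ℕ → ℕ →ᵇ ℝ := fun S => BoundedContinuousFunction.ofNormedAddCommGroupDiscrete
    (S.indicator fun _ => 1) 1 fun i => by by_cases hi : i ∈ S <;> simp [hi]
  have hχint : ∀ (η : Measure ℕ) S, ∫ i, χ S i ∂η = η.real S := fun η S => by
    change ∫ i, S.indicator (fun _ => (1 : ℝ)) i ∂η = _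
    rw [integral_indicator_const _ (MeasurableSet.of_discrete), smul_eq_mul, mul_one]
  obtain ⟨π, hπ, hπe⟩ := exists_coupling_of_content μ ν (m := fun S => F (e S))
    (fun S => hF0 _ fun z => indicator_nonneg (fun _ _ => zero_le_one) z)
    (fun S T hST => by
      rw [← map_add]
      congr 1
      ext z
      simp only [Submodule.coe_add, Pi.add_apply, he]
      rw [indicator_union_of_disjoint hST])
    (fun S => by rw [← hχint]; exact hFμ _ _ fun z => rfl)
    (fun S => by rw [← hχint]; exact hFν _ _ fun z => rfl)
  refine ⟨π, hπ, ?_⟩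
  have hw0 : ∀ z, 0 ≤ F (e {z}) := fun z =>
    hF0 _ fun y => indicator_nonneg (fun _ _ => zero_le_one) y
  rw [lintegral_countable', ENNReal.tsum_eq_iSup_sum]
  refine iSup_le fun s => ?_
  simp only [hπe, ← ENNReal.ofReal_mul (hc _)]
  rw [← ENNReal.ofReal_sum_of_nonneg fun z _ => mul_nonneg (hc z) (hw0 z)]
  refine ENNReal.ofReal_le_ofReal ?_
  have hcm : c ∈ boundedByCost c := ⟨1, fun z => by
    rw [one_mul, abs_of_nonneg (hc z)]; linarith⟩
  have h1 : ∑ z ∈ s, c z * F (e {z}) = F (∑ z ∈ s, c z • e {z}) := by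
    rw [map_sum]
    exact Finset.sum_congr rfl fun z _ => by rw [map_smul, smul_eq_mul]
  refine le_trans ?_ (hFc ⟨c, hcm⟩ fun z => rfl)
  rw [h1, ← sub_nonneg, ← map_sub]
  refine hF0 _ fun y => ?_
  have h2 : (∑ z ∈ s, c z • e {z} : boundedByCost c).1 y = if y ∈ s then c y else 0 := by
    simp only [Submodule.coe_sum, Finset.sum_apply, Submodule.coe_smul, Pi.smul_apply, he,
      smul_eq_mul, indicator_apply, mem_singleton_iff, mul_ite, mul_one, mul_zero,
      Finset.sum_ite_eq]
  rw [Submodule.coe_sub, Pi.sub_apply, sub_nonneg, h2]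
  split_ifs
  · exact le_rfl
  · exact hc y

/-! ### Kantorovich–Rubinstein duality on separable metric spaces -/

section Wasserstein

variable {E : Type*} [PseudoMetricSpace E] [MeasurableSpace E]

/-- Weak duality: integrate `T x - T y ≤ d(x, y)` against a coupling. -/
theorem integral_sub_integral_le_wassersteinDist (μ ν : Measure E) {T : E → ℝ}
    (hT : LipschitzWith 1 T) (hμ : Integrable T μ) (hν : Integrable T ν) :
    ((∫ x, T x ∂μ - ∫ x, T x ∂ν : ℝ) : EReal) ≤ ((wassersteinDist μ ν : ℝ≥0∞) : EReal) := by
  have key : ENNReal.ofReal (∫ x, T x ∂μ - ∫ x, T x ∂ν) ≤ wassersteinDist μ ν := by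
    refine le_iInf₂ fun π hπ => ?_
    obtain ⟨h1, h2⟩ := hπ
    have i1 : Integrable (fun z : E × E => T z.1) π := by
      rw [← h1] at hμ
      exact hμ.comp_measurable measurable_fst
    have i2 : Integrable (fun z : E × E => T z.2) π := by
      rw [← h2] at hν
      exact hν.comp_measurable measurable_snd
    have e1 : ∫ x, T x ∂μ = ∫ z, T z.1 ∂π := by
      rw [← h1] at hμ ⊢
      exact integral_map measurable_fst.aemeasurable hμ.aestronglyMeasurable
    have e2 : ∫ x, T x ∂ν = ∫ z, T z.2 ∂π := by
      rw [← h2] at hν ⊢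
      exact integral_map measurable_snd.aemeasurable hν.aestronglyMeasurable
    rw [e1, e2, ← integral_sub i1 i2]
    refine (ENNReal.ofReal_le_ofReal (le_abs_self _)).trans ?_
    rw [← Real.norm_eq_abs, ofReal_norm]
    refine (enorm_integral_le_lintegral_enorm _).trans (lintegral_mono fun z => ?_)
    have := hT z.1 z.2
    rw [ENNReal.coe_one, one_mul, edist_eq_enorm_sub] at this
    exact this
  have := EReal.coe_ennreal_le_coe_ennreal_iff.2 key
  refine le_trans ?_ this
  rw [EReal.coe_ennreal_ofReal]
  exact EReal.coe_le_coe_iff.2 (le_max_left _ _)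


variable [OpensMeasurableSpace E]

/-- The conditional laws of `p` given the index `ι`, concentrated near the marked points. -/
theorem exists_conditional_laws (p : Measure E) [IsProbabilityMeasure p] {ε : ℝ} {a : ℕ → E}
    {ι : E → ℕ} (hι : Measurable ι) (ha : ∀ x, dist x (a (ι x)) < ε) :
    ∃ κ : ℕ → Measure E, (∀ i, IsProbabilityMeasure (κ i)) ∧
      (∀ i, ∀ᵐ x ∂κ i, dist x (a i) ≤ ε) ∧ (p.map ι).bind κ = p := by
  have hε : 0 ≤ ε := by
    obtain ⟨x⟩ := p.nonempty_of_neZero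
    exact dist_nonneg.trans (ha x).le
  have hB : ∀ i, MeasurableSet (ι ⁻¹' {i}) := fun i => hι (MeasurableSet.singleton i)
  classical
  let κ : ℕ → Measure E := fun i =>
    if p (ι ⁻¹' {i}) = 0 then Measure.dirac (a i) else ProbabilityTheory.cond p (ι ⁻¹' {i})
  refine ⟨κ, fun i => ?_, fun i => ?_, ?_⟩
  · by_cases h : p (ι ⁻¹' {i}) = 0
    · simp only [κ, h, if_true]; infer_instance
    · simp only [κ, h, if_false]
      exact ProbabilityTheory.cond_isProbabilityMeasure h
  · have hm : MeasurableSet {x | dist x (a i) ≤ ε} :=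
      (isClosed_le (by fun_prop) continuous_const).measurableSet
    by_cases h : p (ι ⁻¹' {i}) = 0
    · simp only [κ, h, if_true]
      rw [ae_dirac_iff hm]
      simpa using hε
    · simp only [κ, h, if_false]
      filter_upwards [ProbabilityTheory.ae_cond_mem (μ := p) (hB i)] with x hx
      have hx : ι x = i := hx
      rw [← hx]
      exact (ha x).le
  · ext S hS
    rw [Measure.bind_apply hS (measurable_of_countable κ).aemeasurable, lintegral_countable']
    have h1 : ∀ i, κ i S * (p.map ι) {i} = p (S ∩ ι ⁻¹' {i}) := fun i => by
      rw [Measure.map_apply hι (MeasurableSet.singleton i)]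
      by_cases h : p (ι ⁻¹' {i}) = 0
      · rw [h, mul_zero, measure_mono_null inter_subset_right h]
      · simp only [κ, h, if_false]
        rw [ProbabilityTheory.cond_mul_eq_inter (hB i), inter_comm]
    simp only [h1]
    rw [← measure_iUnion]
    · congr 1
      ext x
      simp
    · intro i j hij
      refine Disjoint.mono inter_subset_right inter_subset_right ?_
      exact Disjoint.preimage ι (by simpa using hij)
    · exact fun i => hS.inter (hB i)

/-- Dual potentials of the discretised problem give a Lipschitz function, by the `c`-transform
`T x = inf_j (r * d(x, a j) - ψ j)`, here truncated at a bound of the potentials. -/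
theorem integral_add_integral_le_of_potentials (p q : Measure E) [IsProbabilityMeasure p]
    [IsProbabilityMeasure q] {K : ℝ} {ε : ℝ} {a : ℕ → E} {ι : E → ℕ} (hι : Measurable ι)
    (ha : ∀ x, dist x (a (ι x)) < ε)
    (hK : ∀ (T : E → ℝ) (r : ℝ), 0 ≤ r → (∀ x y, T x ≤ T y + r * dist x y) →
      Integrable T p → Integrable T q → ∫ x, T x ∂p - ∫ x, T x ∂q ≤ r * K)
    (φ ψ : ℕ →ᵇ ℝ) {r : ℝ} (hr : 0 ≤ r) (h : ∀ i j, φ i + ψ j ≤ r * dist (a i) (a j)) :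
    ∫ i, φ i ∂(p.map ι) + ∫ j, ψ j ∂(q.map ι) ≤ r * (K + 2 * ε) := by
  set C := max ‖φ‖ ‖ψ‖ with hC
  have hφC : ∀ i, φ i ≤ C := fun i =>
    (le_abs_self _).trans ((φ.norm_coe_le_norm i).trans (le_max_left _ _))
  have hψC : ∀ j, ψ j ≤ C := fun j =>
    (le_abs_self _).trans ((ψ.norm_coe_le_norm j).trans (le_max_right _ _))
  have hC0 : 0 ≤ C := (norm_nonneg φ).trans (le_max_left _ _)
  let t : E → ℕ → ℝ := fun x j => min C (r * dist x (a j) - ψ j)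
  have htC : ∀ x j, -C ≤ t x j := fun x j => le_min (by linarith) (by
    have := mul_nonneg hr (dist_nonneg (x := x) (y := a j))
    linarith [hψC j])
  have hbdd : ∀ x, BddBelow (range (t x)) := fun x => ⟨-C, by rintro _ ⟨j, rfl⟩; exact htC x j⟩
  let T : E → ℝ := fun x => ⨅ j, t x j
  have hT1 : ∀ x, -C ≤ T x := fun x => le_ciInf (htC x)
  have hT2 : ∀ x, T x ≤ C := fun x => (ciInf_le (hbdd x) 0).trans (min_le_left _ _)
  have hTlip : ∀ x y, T x ≤ T y + r * dist x y := fun x y => by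
    rw [← sub_le_iff_le_add]
    refine le_ciInf fun j => ?_
    rw [sub_le_iff_le_add]
    refine (ciInf_le (hbdd x) j).trans ?_
    have h1 := mul_le_mul_of_nonneg_left (dist_triangle x y (a j)) hr
    have h2 := mul_nonneg hr (dist_nonneg (x := x) (y := y))
    simp only [t]
    rw [min_add]
    exact min_le_min (by linarith) (by linarith)
  have hTφ : ∀ x, φ (ι x) ≤ T x + r * ε := fun x => by
    have h1 : φ (ι x) ≤ T (a (ι x)) := le_ciInf fun j =>
      le_min (hφC _) (by linarith [h (ι x) j])
    have h2 := hTlip (a (ι x)) x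
    have h3 := mul_le_mul_of_nonneg_left (ha x).le hr
    rw [dist_comm] at h2
    linarith
  have hTψ : ∀ x, ψ (ι x) ≤ -T x + r * ε := fun x => by
    have h1 : T x ≤ r * dist x (a (ι x)) - ψ (ι x) :=
      (ciInf_le (hbdd x) (ι x)).trans (min_le_right _ _)
    have h3 := mul_le_mul_of_nonneg_left (ha x).le hr
    linarith
  have hTm : Measurable T := by
    have : LipschitzWith (Real.toNNReal r) T := LipschitzWith.of_le_add_mul _ fun x y => by
      rw [Real.coe_toNNReal r hr]; exact hTlip x y
    exact this.continuous.measurable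
  have hTint : ∀ (m : Measure E) [IsProbabilityMeasure m], Integrable T m := fun m _ =>
    Integrable.of_bound hTm.aestronglyMeasurable C
      (ae_of_all _ fun x => abs_le.2 ⟨hT1 x, hT2 x⟩)
  have hint : ∀ (m : Measure E) [IsProbabilityMeasure m] (φ : ℕ →ᵇ ℝ),
      Integrable (fun x => φ (ι x)) m := fun m _ φ =>
    Integrable.of_bound ((measurable_of_countable φ).comp hι).aestronglyMeasurable ‖φ‖
      (ae_of_all _ fun x => φ.norm_coe_le_norm _)
  rw [integral_map hι.aemeasurable (measurable_of_countable φ).aestronglyMeasurable,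
    integral_map hι.aemeasurable (measurable_of_countable ψ).aestronglyMeasurable]
  have h1 := integral_mono (hint p φ) ((hTint p).add (integrable_const (r * ε))) hTφ
  have h2 : ∫ x, ψ (ι x) ∂q ≤ ∫ x, (-T x + r * ε) ∂q :=
    integral_mono (hint q ψ) ((hTint q).neg.add (integrable_const (r * ε))) hTψ
  have h3 := hK T r hr hTlip (hTint p) (hTint q)
  simp only [Pi.add_apply] at h1
  rw [integral_add (hTint p) (integrable_const _)] at h1
  rw [integral_add (f := fun x => -T x) (hTint q).neg (integrable_const _), integral_neg] at h2
  simp only [integral_const, probReal_univ, smul_eq_mul, one_mul] at h1 h2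
  linarith

variable [SecondCountableTopology E]

/-- A separable space is the union of countably many disjoint measurable pieces of small diameter,
indexed by `ι`, with marked points `a i`. -/
theorem exists_measurable_index [Nonempty E] {ε : ℝ} (hε : 0 < ε) :
    ∃ (a : ℕ → E) (ι : E → ℕ), Measurable ι ∧ ∀ x, dist x (a (ι x)) < ε := by
  classical
  have h : ∀ x : E, ∃ n, dist x (TopologicalSpace.denseSeq E n) < ε := fun x => by
    exact (TopologicalSpace.denseRange_denseSeq E).exists_dist_lt x hε
  refine ⟨TopologicalSpace.denseSeq E, fun x => Nat.find (h x), ?_, fun x => Nat.find_spec (h x)⟩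
  refine measurable_find h fun n => ?_
  exact (isOpen_lt (by fun_prop) continuous_const).measurableSet

/-- Gluing: a coupling of discretised laws and the conditional laws of the pieces give a coupling
of the original laws, whose cost exceeds the discrete cost by at most twice the mesh. -/
theorem wassersteinDist_bind_le {μ ν : Measure ℕ} {π : Measure (ℕ × ℕ)} [IsProbabilityMeasure π]
    (hπ : π ∈ couplings μ ν) {a : ℕ → E} {ε : ℝ} {κ η : ℕ → Measure E}
    [∀ i, IsProbabilityMeasure (κ i)] [∀ i, IsProbabilityMeasure (η i)]
    (hκ : ∀ i, ∀ᵐ x ∂κ i, dist x (a i) ≤ ε) (hη : ∀ i, ∀ᵐ x ∂η i, dist x (a i) ≤ ε) :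
    wassersteinDist (μ.bind κ) (ν.bind η) ≤
      ∫⁻ z, ENNReal.ofReal (dist (a z.1) (a z.2)) ∂π + ENNReal.ofReal (2 * ε) := by
  let θ : ℕ × ℕ → Measure (E × E) := fun z => (κ z.1).prod (η z.2)
  have hθ : AEMeasurable θ π := (measurable_of_countable θ).aemeasurable
  have hmem : π.bind θ ∈ couplings (μ.bind κ) (ν.bind η) := by
    refine ⟨?_, ?_⟩
    · ext S hS
      rw [Measure.map_apply measurable_fst hS, Measure.bind_apply (measurable_fst hS) hθ,
        Measure.bind_apply hS (measurable_of_countable κ).aemeasurable, ← hπ.1,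
        lintegral_map (measurable_of_countable _) measurable_fst]
      refine lintegral_congr fun z => ?_
      rw [← Measure.map_apply measurable_fst hS, Measure.map_fst_prod]
      simp
    · ext S hS
      rw [Measure.map_apply measurable_snd hS, Measure.bind_apply (measurable_snd hS) hθ,
        Measure.bind_apply hS (measurable_of_countable η).aemeasurable, ← hπ.2,
        lintegral_map (measurable_of_countable _) measurable_snd]
      refine lintegral_congr fun z => ?_
      rw [← Measure.map_apply measurable_snd hS, Measure.map_snd_prod]
      simp
  refine (iInf₂_le _ hmem).trans ?_
  rw [Measure.lintegral_bind hθ measurable_edist.aemeasurable]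
  have hbound : ∀ z, ∫⁻ w, edist w.1 w.2 ∂θ z ≤
      ENNReal.ofReal (dist (a z.1) (a z.2)) + ENNReal.ofReal (2 * ε) := fun z => by
    have h1 : ∀ᵐ w ∂θ z, dist w.1 (a z.1) ≤ ε := Measure.quasiMeasurePreserving_fst.ae (hκ z.1)
    have h2 : ∀ᵐ w ∂θ z, dist w.2 (a z.2) ≤ ε := Measure.quasiMeasurePreserving_snd.ae (hη z.2)
    have h3 : ∀ᵐ w ∂θ z, edist w.1 w.2 ≤
        ENNReal.ofReal (dist (a z.1) (a z.2)) + ENNReal.ofReal (2 * ε) := by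
      filter_upwards [h1, h2] with w hw1 hw2
      have hε : 0 ≤ ε := dist_nonneg.trans hw1
      rw [← ENNReal.ofReal_add dist_nonneg (by linarith), edist_dist]
      refine ENNReal.ofReal_le_ofReal ?_
      have := dist_triangle4 w.1 (a z.1) (a z.2) w.2
      rw [dist_comm (a z.2) w.2] at this
      linarith
    refine (lintegral_mono_ae h3).trans ?_
    simp [θ]
  refine (lintegral_mono hbound).trans ?_
  rw [lintegral_add_right _ measurable_const]
  simp

/-- Strong duality. The duality on `ℕ` is applied to the laws of the index of a countable partition
of mesh `δ / 4`; passing to the discrete problem costs `δ / 2`, and gluing costs `δ / 2`. -/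
theorem wassersteinDist_le_of_lipschitz_bound (p q : Measure E) [IsProbabilityMeasure p]
    [IsProbabilityMeasure q] {K : ℝ}
    (hK : ∀ T : E → ℝ, LipschitzWith 1 T → Integrable T p → Integrable T q →
      ∫ x, T x ∂p - ∫ x, T x ∂q ≤ K) :
    wassersteinDist p q ≤ ENNReal.ofReal K := by
  have hK' : ∀ (T : E → ℝ) (r : ℝ), 0 ≤ r → (∀ x y, T x ≤ T y + r * dist x y) →
      Integrable T p → Integrable T q → ∫ x, T x ∂p - ∫ x, T x ∂q ≤ r * K := by
    intro T r hr hT hp hq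
    rcases hr.eq_or_lt with rfl | hr
    · obtain ⟨x₀⟩ := p.nonempty_of_neZero
      have hconst : ∀ x, T x = T x₀ := fun x =>
        le_antisymm (by simpa using hT x x₀) (by simpa using hT x₀ x)
      simp [hconst]
    · have h1 := hK (fun x => T x / r) (LipschitzWith.of_le_add fun x y => by
        rw [div_le_iff₀ hr, add_mul, div_mul_cancel₀ _ hr.ne', mul_comm (dist x y)]
        exact hT x y) (hp.div_const r) (hq.div_const r)
      rw [integral_div, integral_div, ← sub_div, div_le_iff₀ hr] at h1
      linarith
  have : Nonempty E := p.nonempty_of_neZero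
  have hK0 : 0 ≤ K := by simpa using hK (fun _ => 0) (LipschitzWith.const' 0) (by simp) (by simp)
  refine ENNReal.le_of_forall_pos_le_add fun δ hδ _ => ?_
  set ε : ℝ := δ / 4 with hε
  have hε0 : 0 < ε := by positivity
  obtain ⟨a, ι, hι, ha⟩ := exists_measurable_index (E := E) hε0
  obtain ⟨κ, hκ1, hκ2, hκ3⟩ := exists_conditional_laws p hι ha
  obtain ⟨η, hη1, hη2, hη3⟩ := exists_conditional_laws q hι ha
  have : IsProbabilityMeasure (p.map ι) := Measure.isProbabilityMeasure_map hι.aemeasurable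
  have : IsProbabilityMeasure (q.map ι) := Measure.isProbabilityMeasure_map hι.aemeasurable
  obtain ⟨π, hπ, hcost⟩ := exists_coupling_nat (p.map ι) (q.map ι)
    (fun z => dist (a z.1) (a z.2)) (fun z => dist_nonneg) (K + 2 * ε)
    fun φ ψ r hr h => integral_add_integral_le_of_potentials p q hι ha hK' φ ψ hr h
  have : IsProbabilityMeasure π := ⟨by
    have h1 : (π.map Prod.fst) univ = 1 := by rw [hπ.1]; exact measure_univ
    rwa [Measure.map_apply measurable_fst MeasurableSet.univ, preimage_univ] at h1⟩
  have h := wassersteinDist_bind_le hπ hκ2 hη2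
  rw [hκ3, hη3] at h
  refine h.trans ((add_le_add_left hcost _).trans ?_)
  rw [← ENNReal.ofReal_add (by positivity) (by positivity)]
  have h4 : K + 2 * ε + 2 * ε = K + δ := by rw [hε]; ring
  rw [h4, ENNReal.ofReal_add hK0 δ.coe_nonneg, ENNReal.ofReal_coe_nnreal]

/-- Kantorovich–Rubinstein duality; the laws need not have a first moment. -/
theorem coe_wassersteinDist_eq_iSup (p q : Measure E) [IsProbabilityMeasure p]
    [IsProbabilityMeasure q] :
    ((wassersteinDist p q : ℝ≥0∞) : EReal) =
      ⨆ (T : E → ℝ) (_ : LipschitzWith 1 T ∧ Integrable T p ∧ Integrable T q),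
        ((∫ x, T x ∂p - ∫ x, T x ∂q : ℝ) : EReal) := by
  refine le_antisymm ?_ (iSup₂_le fun T hT =>
    integral_sub_integral_le_wassersteinDist p q hT.1 hT.2.1 hT.2.2)
  set S := ⨆ (T : E → ℝ) (_ : LipschitzWith 1 T ∧ Integrable T p ∧ Integrable T q),
        ((∫ x, T x ∂p - ∫ x, T x ∂q : ℝ) : EReal) with hS
  have hle : ∀ T : E → ℝ, LipschitzWith 1 T → Integrable T p → Integrable T q →
      ((∫ x, T x ∂p - ∫ x, T x ∂q : ℝ) : EReal) ≤ S := fun T h1 h2 h3 =>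
    le_iSup₂ (f := fun (T : E → ℝ) (_ : LipschitzWith 1 T ∧ Integrable T p ∧ Integrable T q) =>
      ((∫ x, T x ∂p - ∫ x, T x ∂q : ℝ) : EReal)) T ⟨h1, h2, h3⟩
  have h0 : (0 : EReal) ≤ S := by
    simpa using hle (fun _ => 0) (LipschitzWith.const' 0) (by simp) (by simp)
  rcases eq_or_ne S ⊤ with htop | htop
  · rw [htop]; exact le_top
  have hbot : S ≠ ⊥ := ne_bot_of_le_ne_bot EReal.zero_ne_bot h0
  have hSK : ((S.toReal : ℝ) : EReal) = S := EReal.coe_toReal htop hbot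
  have h := wassersteinDist_le_of_lipschitz_bound p q (K := S.toReal) fun T h1 h2 h3 => by
    rw [← EReal.coe_le_coe_iff, hSK]; exact hle T h1 h2 h3
  refine (EReal.coe_ennreal_le_coe_ennreal_iff.2 h).trans ?_
  rw [EReal.coe_ennreal_ofReal, max_eq_left (EReal.toReal_nonneg h0), hSK]

end Wasserstein

/-! ### Multivariate dependency measures -/

theorem continuous_toL2Prod {A V L : Type*} [MetricSpace A] [MetricSpace V] [MetricSpace L] :
    Continuous (toL2Prod : A × V × L → L2Prod A V L) := by
  unfold toL2Prod
  fun_prop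

theorem theorem1 {Ω A V L : Type*} [MeasurableSpace Ω] (P : Measure Ω) [IsProbabilityMeasure P]
    [MetricSpace A] [CompleteSpace A] [SecondCountableTopology A] [MeasurableSpace A] [BorelSpace A]
    [MetricSpace V] [CompleteSpace V] [SecondCountableTopology V] [MeasurableSpace V] [BorelSpace V]
    [MetricSpace L] [CompleteSpace L] [SecondCountableTopology L] [MeasurableSpace L] [BorelSpace L]
    (Xa : Ω → A) (Xv : Ω → V) (Xl : Ω → L)
    (hXa : Measurable Xa) (hXv : Measurable Xv) (hXl : Measurable Xl) :
    -- total correlation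
    ((totalCorrelation P Xa Xv Xl : ℝ≥0∞) : EReal) =
      (⨆ (T : A × V × L → ℝ) (_ : Measurable T ∧ Integrable T (jointLaw P Xa Xv Xl) ∧
          Integrable (fun x => Real.exp (T x)) (prodLaw P Xa Xv Xl)),
        ((∫ x, T x ∂(jointLaw P Xa Xv Xl)
          - Real.log (∫ x, Real.exp (T x) ∂(prodLaw P Xa Xv Xl)) : ℝ) : EReal)) ∧
    -- `f`-mutual information, for every generator `f`
    (∀ f : ℝ → ℝ, ConvexOn ℝ (Ioi 0) f → f 1 = 0 →
      fMutualInfo f P Xa Xv Xl =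
        ⨆ (T : A × V × L → ℝ) (_ : Measurable T ∧ Integrable T (jointLaw P Xa Xv Xl) ∧
            (∀ x, fConj f (T x) ≠ ⊤) ∧
            Integrable (fun x => (fConj f (T x)).toReal) (prodLaw P Xa Xv Xl)),
          ((∫ x, T x ∂(jointLaw P Xa Xv Xl)
            - ∫ x, (fConj f (T x)).toReal ∂(prodLaw P Xa Xv Xl) : ℝ) : EReal)) ∧
    -- `f`-mutual information for `f(u) = u log u`, where `f*(t) = exp (t - 1)`
    fMutualInfo (fun u => u * Real.log u) P Xa Xv Xl =
      (⨆ (T : A × V × L → ℝ) (_ : Measurable T ∧ Integrable T (jointLaw P Xa Xv Xl) ∧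
          Integrable (fun x => Real.exp (T x - 1)) (prodLaw P Xa Xv Xl)),
        ((∫ x, T x ∂(jointLaw P Xa Xv Xl)
          - ∫ x, Real.exp (T x - 1) ∂(prodLaw P Xa Xv Xl) : ℝ) : EReal)) ∧
    -- Wasserstein dependency measure
    ((wassersteinDependency P Xa Xv Xl : ℝ≥0∞) : EReal) =
      (⨆ (T : L2Prod A V L → ℝ) (_ : LipschitzWith 1 T ∧
          Integrable (fun x => T (toL2Prod x)) (jointLaw P Xa Xv Xl) ∧
          Integrable (fun x => T (toL2Prod x)) (prodLaw P Xa Xv Xl)),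
        ((∫ x, T (toL2Prod x) ∂(jointLaw P Xa Xv Xl)
          - ∫ x, T (toL2Prod x) ∂(prodLaw P Xa Xv Xl) : ℝ) : EReal)) := by
  have hJ : IsProbabilityMeasure (jointLaw P Xa Xv Xl) :=
    Measure.isProbabilityMeasure_map (hXa.prodMk (hXv.prodMk hXl)).aemeasurable
  have hA : IsProbabilityMeasure (P.map Xa) := Measure.isProbabilityMeasure_map hXa.aemeasurable
  have hV : IsProbabilityMeasure (P.map Xv) := Measure.isProbabilityMeasure_map hXv.aemeasurable
  have hL : IsProbabilityMeasure (P.map Xl) := Measure.isProbabilityMeasure_map hXl.aemeasurable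
  have hQ : IsProbabilityMeasure (prodLaw P Xa Xv Xl) := by unfold prodLaw; infer_instance
  refine ⟨coe_klDiv_eq_iSup _ _, fun f hf _ => fDiv_eq_iSup _ _ hf, fDiv_mul_log_eq_iSup _ _, ?_⟩
  have hm : Measurable (toL2Prod : A × V × L → L2Prod A V L) := continuous_toL2Prod.measurable
  have hJ' := Measure.isProbabilityMeasure_map (μ := jointLaw P Xa Xv Xl) hm.aemeasurable
  have hQ' := Measure.isProbabilityMeasure_map (μ := prodLaw P Xa Xv Xl) hm.aemeasurable
  rw [wassersteinDependency, coe_wassersteinDist_eq_iSup]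
  refine iSup_congr fun T => ?_
  have hT : ∀ (η : Measure (A × V × L)), LipschitzWith 1 T →
      (Integrable T (η.map toL2Prod) ↔ Integrable (fun x => T (toL2Prod x)) η) ∧
      ∫ y, T y ∂(η.map toL2Prod) = ∫ x, T (toL2Prod x) ∂η := fun η h =>
    ⟨integrable_map_measure h.continuous.measurable.aestronglyMeasurable hm.aemeasurable,
      integral_map hm.aemeasurable h.continuous.measurable.aestronglyMeasurable⟩
  refine iSup_congr_Prop ?_ ?_
  · exact and_congr_right fun h => and_congr (hT _ h).1 (hT _ h).1
  · intro h
    rw [(hT _ h.1).2, (hT _ h.1).2]
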